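/- Let $p$ be a prime and $X$ a finite set. For a commutative unital algebra $A$ over a commutative ring $\mathbf{k}$ and $\lambda\in\mathbf{k}$, let $\mathrm{Sh}_{\lambda}(A)=\bigoplus_{n\ge 0}A^{\otimes n}$ be the mixable shuffle algebra of weight $\lambda$: its product $*$ is bilinear, has unit $1\in A^{\otimes 0}=\mathbf k$, and satisfies $$(a\otimes u)*(b\otimes v)=a\otimes(u*(b\otimes v))+b\otimes((a\otimes u)*v)+\lambda\,(ab)\otimes(u*v)\qquad(a,b\in A,\ u,v\in \mathrm{Sh}_\lambda(A)).$$ Let $\mathcal{R}_{\mathbf k,\lambda}(A)=A\otimes \mathrm{Sh}_{\lambda}(A)$ (tensor product algebra), the free commutative Rota–Baxter algebra of weight $\lambda$ generated by $A$. For a commutative monoid $S$ with a total order, words $w=s_1\otimes\cdots\otimes s_n$ over $S$ are compared lexicographically, $\ell(w)=n$, $w^{\otimes m}$ is the $m$-fold concatenation power, and $w^{(p)}=s_1^p\otimes\cdots\otimes s_n^p$. A Lyndon word is a nonempty word smaller than each of its proper nonempty right factors; $L=L(S)$ is the set of Lyndon words. For a set $W$ of words put $W_1=\{w\in W: w^{(p)}=w\}$,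 $W_2=\{w\in W:w^{(p)}\ne w\}$, $T(W)=\{w^{\otimes p^i}: w\in W,\ i\ge 0\}$, and let $E(W)$ be the set of $w\in W$ such that $w=w^{(p)}$ or $w\neq u^{(p)}$ for every word $u$. Put $TL=T(L)$, $TL_i=T(L_i)$, $TEL=T(E(L))$, $TEL_i=T(E(L_i))$ and $\mathcal D=\{w-w^{(p)}: w\in TL_2\}$. If $S$ is the monomial basis of $A$, words over $S$ are regarded as pure tensors in $\mathrm{Sh}_\lambda(A)$. For a set $Y$ of elements of $\mathrm{Sh}_\lambda(A)$, $\overline Y=\{\overline y:y\in Y\}$ is a set of independent variables in bijection with $Y$. For a nonempty word $w$ put $\lambda_w=\lambda^{(\ell(w)-1)(p-1)}$. Then there are the following isomorphisms of $\mathbb F_p$-algebras. In each of them $a\otimes 1$ ($a\in A$) corresponds to the element $a$ of the factor $A$, resp. $x\otimes 1$ ($x\in X$) to the variable $x$, and $1\otimes y$ corresponds to the variable $\overline y$. 1. Let $S$ be the free commutative monoid on $X$, with any well-order. Then $$\mathcal{R}_{\mathbb F_p,0}(\mathbb F_p[X])\cong \mathbb F_p[X]\otimes\bigl(\mathbb F_p[\overline{TL}]/\langle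 \overline w^{\,p} : w\in TL\rangle\bigr).$$ 2. Let $\lambda\in\mathbb F_p$, $\lambda\ne0$, and let $S$ be the free commutative monoid on $X$, with any well-order such that $a>b$ implies $a^p>b^p$, and $a^p\ge a$, for all $a,b\in S$ (for example the graded lexicographic order given by a total order of $X$). With $W=\{1^{\otimes p^i}: i\ge 0\}$, $$\mathcal{R}_{\mathbb F_p,\lambda}(\mathbb F_p[X])\cong \mathbb F_p[X\sqcup\overline{TEL_2}]\otimes\bigl(\mathbb F_p[\overline W]/\langle \overline w^{\,p}-\lambda_w\overline w: w\in W\rangle\bigr).$$ 3. Let $A=\mathbb F_p[X]/\langle x^p-x: x\in X\rangle$ and $0\ne\lambda\in\mathbb F_p$. Let $G=\{e\}\cup\mu_{p-1}$ be the cyclic group $\mu_{p-1}=\langle\xi\rangle$ of order $p-1$ with a new identity $e$ adjoined, and let $S=G^X$ with any total order. There is an isomorphism $\mathbb F_pS\cong A$ sending, for each $x\in X$, the element of $S$ with entry $\xi$ at $x$ and $e$ elsewhere to $x$. With $S$ viewed in $A$ through it, and $TEL=TEL(S)$, $$\mathcal{R}_{\mathbb F_p,\lambda}(A)\cong \mathbb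 F_p[X\sqcup\overline{TEL}]\big/\bigl\langle x^p-x,\ \overline w^{\,p}-\lambda_w\overline w : x\in X,\ w\in TEL\bigr\rangle.$$ 4. Let $A=\mathbb F_p[X]/\langle x^p-1: x\in X\rangle$ and $0\ne\lambda\in\mathbb F_p$. Let $\mu_p$ be the cyclic group of order $p$ and $S=\mu_p^X$, with any total order in which the identity is the smallest element. There is an isomorphism $\mathbb F_pS\cong A$ sending, for each $x\in X$, the element with a fixed generator of $\mu_p$ at $x$ and $1$ elsewhere to $x$. With $S$ viewed in $A$ through it, and $TL_1=TL_1(S)$, $\mathcal D=\mathcal D(S)$, $$\mathcal{R}_{\mathbb F_p,\lambda}(A)\cong A\otimes\bigl(\mathbb F_p[\overline{TL_1}]/\langle \overline w^{\,p}-\lambda_w\overline w: w\in TL_1\rangle\bigr)\otimes\bigl(\mathbb F_p[\overline{\mathcal D}]/\langle \overline z^{\,p}: z\in \mathcal D\rangle\bigr).$$ -/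

import Mathlib

open scoped TensorProduct

section MixableShuffle

variable {k : Type*} [CommRing k] {A : Type*} [CommRing A] [Algebra k A]

theorem TensorAlgebra.cons_induction {P : TensorAlgebra k A → Prop}
    (one : P 1) (add : ∀ u v, P u → P v → P (u + v)) (smul : ∀ (r : k) u, P u → P (r • u))
    (cons : ∀ a u, P u → P (TensorAlgebra.ι k a * u)) (u : TensorAlgebra k A) : P u := by
  suffices h : ∀ x u : TensorAlgebra k A, P u → P (x * u) by simpa using h u 1 one
  intro x
  induction x using TensorAlgebra.induction with
  | algebraMap r => intro u hu; rw [← Algebra.smul_def]; exact smul r u hu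
  | ι a => exact fun u hu => cons a u hu
  | mul x y hx hy => intro u hu; rw [mul_assoc]; exact hx _ (hy _ hu)
  | add x y hx hy => intro u hu; rw [add_mul]; exact add _ _ (hx _ hu) (hy _ hu)

namespace MixableShuffle

/-- One step of the recursion on the right factor: it sends `(x, v)` to
`(b ⊗ x + a ⊗ m (b ⊗ v) + lam • (a * b) ⊗ m v, b ⊗ v)`. -/
noncomputable def step (lam : k) (a : A) (m : Module.End k (TensorAlgebra k A)) :
    A →ₗ[k] Module.End k (TensorAlgebra k A × TensorAlgebra k A) :=
  LinearMap.mk₂ k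
    (fun b s => (TensorAlgebra.ι k b * s.1 + TensorAlgebra.ι k a * m (TensorAlgebra.ι k b * s.2)
        + lam • (TensorAlgebra.ι k (a * b) * m s.2), TensorAlgebra.ι k b * s.2))
    (fun b b' s => by ext <;> simp [mul_add, add_mul, smul_add]; abel)
    (fun c b s => by ext <;> simp [smul_add, smul_comm lam c])
    (fun b s s' => by ext <;> simp [mul_add, smul_add]; abel)
    (fun c b s => by ext <;> simp [smul_add, smul_comm lam c])

theorem step_apply (lam : k) (a : A) (m : Module.End k (TensorAlgebra k A)) (b : A)
    (s : TensorAlgebra k A × TensorAlgebra k A) :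
    step lam a m b s =
      (TensorAlgebra.ι k b * s.1 + TensorAlgebra.ι k a * m (TensorAlgebra.ι k b * s.2)
        + lam • (TensorAlgebra.ι k (a * b) * m s.2), TensorAlgebra.ι k b * s.2) := rfl

/-- Given the operator `m` of multiplication by `u`, the operator of multiplication by `a ⊗ u`. -/
noncomputable def next (lam : k) (a : A) (m : Module.End k (TensorAlgebra k A)) :
    Module.End k (TensorAlgebra k A) :=
  LinearMap.fst k _ _ ∘ₗ
    LinearMap.applyₗ (TensorAlgebra.ι k a * m 1, 1) ∘ₗ
      (TensorAlgebra.lift k (step lam a m)).toLinearMap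

theorem step_snd (lam : k) (a : A) (m : Module.End k (TensorAlgebra k A))
    (v : TensorAlgebra k A) (s : TensorAlgebra k A × TensorAlgebra k A) :
    (TensorAlgebra.lift k (step lam a m) v s).2 = v * s.2 := by
  induction v using TensorAlgebra.cons_induction with
  | one => simp
  | add u v hu hv => simp [hu, hv, add_mul]
  | smul r u hu => simp [hu]
  | cons b u hu => simp [step_apply, hu, mul_assoc]

@[simp] theorem next_one (lam : k) (a : A) (m : Module.End k (TensorAlgebra k A)) :
    next lam a m 1 = TensorAlgebra.ι k a * m 1 := by
  simp [next]

@[simp] theorem next_cons (lam : k) (a : A) (m : Module.End k (TensorAlgebra k A)) (b : A)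
    (v : TensorAlgebra k A) :
    next lam a m (TensorAlgebra.ι k b * v) =
      TensorAlgebra.ι k a * m (TensorAlgebra.ι k b * v) + TensorAlgebra.ι k b * next lam a m v
        + lam • (TensorAlgebra.ι k (a * b) * m v) := by
  have h := step_snd lam a m v (TensorAlgebra.ι k a * m 1, 1)
  simp only [mul_one] at h
  simp [next, step_apply, h]
  abel

/-- `next`, bundled as a linear map in both arguments. -/
noncomputable def nextₗ (lam : k) :
    A →ₗ[k] Module.End k (Module.End k (TensorAlgebra k A)) :=
  LinearMap.mk₂ k (next lam)
    (fun a a' m => by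
      ext v
      induction v using TensorAlgebra.cons_induction with
      | one => simp [add_mul]
      | add u v hu hv => simp only [map_add, hu, hv]
      | smul r u hu => simp only [map_smul, hu]
      | cons b u hu => simp only [LinearMap.add_apply, next_cons] at hu ⊢; simp [hu, add_mul, mul_add]; abel)
    (fun c a m => by
      ext v
      induction v using TensorAlgebra.cons_induction with
      | one => simp
      | add u v hu hv => simp only [map_add, hu, hv]
      | smul r u hu => simp only [map_smul, hu]
      | cons b u hu =>
        simp only [LinearMap.smul_apply, next_cons] at hu ⊢; simp [hu, smul_comm lam c])
    (fun a m m' => by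
      ext v
      induction v using TensorAlgebra.cons_induction with
      | one => simp [mul_add]
      | add u v hu hv => simp only [map_add, hu, hv]
      | smul r u hu => simp only [map_smul, hu]
      | cons b u hu => simp only [LinearMap.add_apply, next_cons] at hu ⊢; simp [hu, mul_add]; abel)
    (fun c a m => by
      ext v
      induction v using TensorAlgebra.cons_induction with
      | one => simp
      | add u v hu hv => simp only [map_add, hu, hv]
      | smul r u hu => simp only [map_smul, hu]
      | cons b u hu =>
        simp only [LinearMap.smul_apply, next_cons] at hu ⊢; simp [hu, smul_comm lam c])

/-- The mixable shuffle product of weight `lam` on `⨁ₙ A^{⊗ n}`; see `product_one_left`,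
`product_one_right` and `product_cons_cons` for the recursion that determines it. -/
noncomputable def product (lam : k) :
    TensorAlgebra k A →ₗ[k] TensorAlgebra k A →ₗ[k] TensorAlgebra k A :=
  LinearMap.applyₗ LinearMap.id ∘ₗ (TensorAlgebra.lift k (nextₗ (A := A) lam)).toLinearMap

theorem product_one_left (lam : k) (v : TensorAlgebra k A) : product lam 1 v = v := by
  simp [product]

theorem product_cons (lam : k) (a : A) (u : TensorAlgebra k A) :
    product lam (TensorAlgebra.ι k a * u) = next lam a (product lam u) := by
  simp [product, nextₗ]

theorem product_one_right (lam : k) (u : TensorAlgebra k A) : product lam u 1 = u := by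
  induction u using TensorAlgebra.cons_induction with
  | one => exact product_one_left lam 1
  | add u v hu hv => simp only [map_add, LinearMap.add_apply, hu, hv]
  | smul r u hu => simp only [map_smul, LinearMap.smul_apply, hu]
  | cons a u hu => rw [product_cons, next_one, hu]

theorem product_cons_cons (lam : k) (a b : A) (u v : TensorAlgebra k A) :
    product lam (TensorAlgebra.ι k a * u) (TensorAlgebra.ι k b * v) =
      TensorAlgebra.ι k a * product lam u (TensorAlgebra.ι k b * v)
        + TensorAlgebra.ι k b * product lam (TensorAlgebra.ι k a * u) v
        + lam • (TensorAlgebra.ι k (a * b) * product lam u v) := by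
  rw [product_cons, next_cons]

theorem product_comm (lam : k) (u v : TensorAlgebra k A) : product lam u v = product lam v u := by
  induction u using TensorAlgebra.cons_induction generalizing v with
  | one => rw [product_one_left, product_one_right]
  | add u u' hu hu' => simp only [map_add, LinearMap.add_apply, hu, hu']
  | smul r u hu => simp only [map_smul, LinearMap.smul_apply, hu]
  | cons a u hu =>
    induction v using TensorAlgebra.cons_induction with
    | one => rw [product_one_left, product_one_right]
    | add v v' hv hv' => simp only [map_add, LinearMap.add_apply, hv, hv']
    | smul r v hv => simp only [map_smul, LinearMap.smul_apply, hv]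
    | cons b v hv =>
      rw [product_cons_cons, product_cons_cons, hu, hu, hv, mul_comm a b]
      abel

theorem product_assoc (lam : k) (u v w : TensorAlgebra k A) :
    product lam (product lam u v) w = product lam u (product lam v w) := by
  induction u using TensorAlgebra.cons_induction generalizing v w with
  | one => simp only [product_one_left]
  | add u u' hu hu' => simp only [map_add, LinearMap.add_apply, hu, hu']
  | smul r u hu => simp only [map_smul, LinearMap.smul_apply, hu]
  | cons a u hu =>
    induction v using TensorAlgebra.cons_induction generalizing w with
    | one => simp only [product_one_left, product_one_right]
    | add v v' hv hv' => simp only [map_add, LinearMap.add_apply, hv, hv']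
    | smul r v hv => simp only [map_smul, LinearMap.smul_apply, hv]
    | cons b v hv =>
      induction w using TensorAlgebra.cons_induction with
      | one => simp only [product_one_right]
      | add w w' hw hw' => simp only [map_add, hw, hw']
      | smul r w hw => simp only [map_smul, hw]
      | cons c w hw =>
        have h := congrArg (TensorAlgebra.ι k c * ·) hw
        rw [product_cons_cons lam a b u v] at h ⊢
        rw [product_cons_cons lam b c v w]
        simp only [product_cons_cons, map_add, map_smul, LinearMap.add_apply,
          LinearMap.smul_apply, mul_add, smul_add, mul_smul_comm, hu, hv, mul_assoc] at h ⊢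
        linear_combination (norm := module) h

end MixableShuffle

/-- The mixable shuffle algebra `Sh(A) = ⨁ₙ A^{⊗ n}` of weight `lam`.  As a module it is the tensor
algebra of the module `A`; its multiplication is the mixable shuffle product, not concatenation. -/
def MixableShuffle (k : Type*) [CommRing k] (_lam : k) (A : Type*) [CommRing A] [Algebra k A] :
    Type _ :=
  TensorAlgebra k A

namespace MixableShuffle

variable (lam : k)

noncomputable instance : AddCommGroup (MixableShuffle k lam A) :=
  inferInstanceAs (AddCommGroup (TensorAlgebra k A))

noncomputable instance : Module k (MixableShuffle k lam A) :=
  inferInstanceAs (Module k (TensorAlgebra k A))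

noncomputable instance : CommRing (MixableShuffle k lam A) :=
  { (inferInstance : AddCommGroup (MixableShuffle k lam A)) with
    mul := fun u v => product lam u v
    one := (1 : TensorAlgebra k A)
    left_distrib := fun u v w => map_add (product lam u) v w
    right_distrib := fun u v w => LinearMap.map_add₂ (product lam) u v w
    zero_mul := fun u => LinearMap.map_zero₂ (product lam) u
    mul_zero := fun u => map_zero (product lam u)
    mul_assoc := product_assoc lam
    one_mul := product_one_left lam
    mul_one := product_one_right lam
    mul_comm := product_comm lam }

noncomputable instance : Algebra k (MixableShuffle k lam A) :=
  Algebra.ofModule (fun r u v => LinearMap.map_smul₂ (product lam) r u v)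
    (fun r u v => map_smul (product lam u) r v)

/-- The pure tensor `f s₁ ⊗ ⋯ ⊗ f sₙ` attached to a word `s₁ ⋯ sₙ` and a map `f : S → A`
(the product in the definition is concatenation of tensors). -/
noncomputable def word {S : Type*} (f : S → A) (w : List S) : MixableShuffle k lam A :=
  ((w.map fun s => TensorAlgebra.ι k (f s)).prod : TensorAlgebra k A)

end MixableShuffle

end MixableShuffle

section RotaBaxter

/-- The free commutative Rota-Baxter algebra of weight `lam` on the commutative algebra `A`:
the tensor product algebra `A ⊗ Sh(A)`. -/
abbrev FreeCommRotaBaxter (k : Type*) [CommRing k] (lam : k) (A : Type*) [CommRing A]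
    [Algebra k A] : Type _ :=
  A ⊗[k] MixableShuffle k lam A

namespace FreeCommRotaBaxter

variable {k : Type*} [CommRing k] (lam : k) {A : Type*} [CommRing A] [Algebra k A]

/-- The map `A ⊗ Sh(A) → Sh(A)`, `a ⊗ u ↦ a ⊗ u`, prepending a tensor factor. -/
noncomputable def cons : FreeCommRotaBaxter k lam A →ₗ[k] MixableShuffle k lam A :=
  TensorProduct.lift ((LinearMap.mul k (TensorAlgebra k A)).comp (TensorAlgebra.ι k))

/-- The Rota-Baxter operator `x₀ ⊗ x₁ ⊗ ⋯ ⊗ xₙ ↦ 1 ⊗ x₀ ⊗ x₁ ⊗ ⋯ ⊗ xₙ`. -/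
noncomputable def P : FreeCommRotaBaxter k lam A →ₗ[k] FreeCommRotaBaxter k lam A :=
  TensorProduct.mk k A (MixableShuffle k lam A) 1 ∘ₗ cons lam

theorem cons_mul_cons (x y : FreeCommRotaBaxter k lam A) :
    cons lam x * cons lam y =
      cons lam (x * P lam y) + cons lam (P lam x * y) + lam • cons lam (x * y) := by
  induction x using TensorProduct.induction_on with
  | zero => simp
  | add x x' hx hx' => simp only [map_add, add_mul, hx, hx', smul_add]; abel
  | tmul a u =>
    induction y using TensorProduct.induction_on with
    | zero => simp
    | add y y' hy hy' => simp only [map_add, mul_add, hy, hy', smul_add]; abel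
    | tmul b v =>
      simp only [P, LinearMap.comp_apply, TensorProduct.mk_apply,
        Algebra.TensorProduct.tmul_mul_tmul, mul_one, one_mul]
      exact MixableShuffle.product_cons_cons lam a b u v

theorem rotaBaxter (x y : FreeCommRotaBaxter k lam A) :
    P lam x * P lam y = P lam (x * P lam y) + P lam (P lam x * y) + lam • P lam (x * y) := by
  have h := congrArg (TensorProduct.mk k A (MixableShuffle k lam A) 1) (cons_mul_cons lam x y)
  simp only [map_add, map_smul, TensorProduct.mk_apply] at h
  simpa [P] using h

end FreeCommRotaBaxter

end RotaBaxter

section Words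

/-- Lyndon words: non-empty words that are lexicographically smaller than each of their proper
non-empty right factors. -/
def IsLyndon {S : Type*} [LinearOrder S] (w : List S) : Prop :=
  w ≠ [] ∧ ∀ u v : List S, u ≠ [] → v ≠ [] → w = u ++ v → List.Lex (· < ·) w v

/-- The concatenation power `w^{⊗ n}` of a word. -/
def wordPow {S : Type*} (w : List S) (n : ℕ) : List S := (List.replicate n w).flatten

/-- The letterwise power `s₁^p ⊗ ⋯ ⊗ sₙ^p` of the word `s₁ ⊗ ⋯ ⊗ sₙ`. -/
def letterPow {S : Type*} [CommMonoid S] (p : ℕ) (w : List S) : List S := w.map (· ^ p)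

/-- `T(W) = {w^{⊗ p^i} | w ∈ W, i ≥ 0}`. -/
def opT {S : Type*} (p : ℕ) (W : Set (List S)) : Set (List S) :=
  {v | ∃ w ∈ W, ∃ i : ℕ, v = wordPow w (p ^ i)}

/-- `W₁`, the words of `W` fixed by the letterwise `p`-th power. -/
def opOne {S : Type*} [CommMonoid S] (p : ℕ) (W : Set (List S)) : Set (List S) :=
  {w ∈ W | letterPow p w = w}

/-- `W₂`, the words of `W` not fixed by the letterwise `p`-th power. -/
def opTwo {S : Type*} [CommMonoid S] (p : ℕ) (W : Set (List S)) : Set (List S) :=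
  {w ∈ W | letterPow p w ≠ w}

/-- `E(W)`, the words of `W` that are fixed by the letterwise `p`-th power or are not the letterwise
`p`-th power of any word. -/
def opE {S : Type*} [CommMonoid S] (p : ℕ) (W : Set (List S)) : Set (List S) :=
  {w ∈ W | w = letterPow p w ∨ ∀ u : List S, w ≠ letterPow p u}

variable (p : ℕ) (S : Type*) [CommMonoid S] [LinearOrder S]

/-- The set `L` of Lyndon words. -/
def setL : Set (List S) := {w | IsLyndon w}

/-- `TL = T(L)`. -/
def setTL : Set (List S) := opT p (setL S)

/-- `TL₁ = T(L₁)`. -/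
def setTL₁ : Set (List S) := opT p (opOne p (setL S))

/-- `TL₂ = T(L₂)`. -/
def setTL₂ : Set (List S) := opT p (opTwo p (setL S))

/-- `TEL = T(E(L))`. -/
def setTEL : Set (List S) := opT p (opE p (setL S))

/-- `TEL₂ = T(E(L₂))`. -/
def setTEL₂ : Set (List S) := opT p (opE p (opTwo p (setL S)))

/-- The set `{w - w^{(p)} | w ∈ TL₂}` in `Sh(A)`, with words read in `Sh(A)` through `f`. -/
def setTL₂Diff {S : Type*} [CommMonoid S] [LinearOrder S] {k : Type*} [CommRing k] (lam : k)
    {A : Type*} [CommRing A] [Algebra k A] (f : S → A) : Set (MixableShuffle k lam A) :=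
  {z | ∃ w ∈ setTL₂ p S,
    z = MixableShuffle.word lam f w - MixableShuffle.word lam f (letterPow p w)}

/-- The set of words `1^{⊗ p^i}`, `i ≥ 0`. -/
def setW (S : Type*) [CommMonoid S] : Set (List S) := {w | ∃ i : ℕ, w = wordPow [1] (p ^ i)}

/-- The class of well-ordered commutative monoids in which `a ↦ a ^ p` is strictly increasing and
`a ≤ a ^ p`. -/
structure InClassG : Prop where
  wellFoundedLT : WellFoundedLT S
  pow_lt_pow : ∀ a b : S, b < a → b ^ p < a ^ p
  le_pow : ∀ a : S, a ≤ a ^ p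

end Words

section Monoids

/-- The free commutative monoid on `X`, with no order attached. -/
def FreeCommMonoid (X : Type*) : Type _ := Multiplicative (X →₀ ℕ)

noncomputable instance (X : Type*) : CommMonoid (FreeCommMonoid X) :=
  inferInstanceAs (CommMonoid (Multiplicative (X →₀ ℕ)))

/-- The element of `k[X]` given by an element of the free commutative monoid on `X`. -/
noncomputable def FreeCommMonoid.toPoly (k : Type*) [CommRing k] {X : Type*}
    (s : FreeCommMonoid X) : MvPolynomial X k :=
  MvPolynomial.monomial (Multiplicative.toAdd (show Multiplicative (X →₀ ℕ) from s)) 1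

/-- The graded lexicographic order on the free commutative monoid on `X`. -/
@[reducible] noncomputable def FreeCommMonoid.gradedLex (X : Type*) [LinearOrder X] [WellFoundedGT X] :
    LinearOrder (FreeCommMonoid X) :=
  LinearOrder.lift'
    (fun s => toDegLex (Multiplicative.toAdd (show Multiplicative (X →₀ ℕ) from s)))
    (fun _ _ h => h)

theorem FreeCommMonoid.gradedLex_inClassG (X : Type*) [LinearOrder X] [Finite X] (p : ℕ)
    (hp : p ≠ 0) :
    @InClassG p (FreeCommMonoid X) _ (FreeCommMonoid.gradedLex X) := by
  let := FreeCommMonoid.gradedLex X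
  let φ : FreeCommMonoid X → DegLex (X →₀ ℕ) :=
    fun s => toDegLex (Multiplicative.toAdd (show Multiplicative (X →₀ ℕ) from s))
  have hpow : ∀ a, φ (a ^ p) = p • φ a := fun _ => rfl
  refine ⟨⟨InvImage.wf φ (Finsupp.DegLex.wellFoundedLT (α := X)).wf⟩, fun a b h => ?_, fun a => ?_⟩
  · change φ (b ^ p) < φ (a ^ p)
    rw [hpow, hpow]
    exact nsmul_lt_nsmul_right hp h
  · change φ a ≤ φ (a ^ p)
    rw [hpow]
    exact le_self_nsmul (bot_le (a := φ a)) hp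

/-- The monoid `G^X`, where `G = {e} ∪ μ_{p-1}` is the cyclic group of order `p - 1` with a new
identity `e` adjoined. -/
def IdemMonoid (p : ℕ) (X : Type*) : Type _ := X → WithOne (Multiplicative (ZMod (p - 1)))

instance (p : ℕ) (X : Type*) : CommMonoid (IdemMonoid p X) :=
  inferInstanceAs (CommMonoid (X → WithOne (Multiplicative (ZMod (p - 1)))))

/-- The element of `G^X` that is the generator `ξ` of `μ_{p-1}` at `x` and `e` elsewhere. -/
def IdemMonoid.gen (p : ℕ) {X : Type*} [DecidableEq X] (x : X) : IdemMonoid p X :=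
  fun y => if y = x then ((Multiplicative.ofAdd 1 : Multiplicative (ZMod (p - 1))) : WithOne _)
    else 1

/-- The group `μ_p^X`. -/
def ElemGroup (p : ℕ) (X : Type*) : Type _ := X → Multiplicative (ZMod p)

instance (p : ℕ) (X : Type*) : CommGroup (ElemGroup p X) :=
  inferInstanceAs (CommGroup (X → Multiplicative (ZMod p)))

/-- The element of `μ_p^X` that is the standard generator at `x` and the identity elsewhere. -/
def ElemGroup.gen (p : ℕ) {X : Type*} [DecidableEq X] (x : X) : ElemGroup p X :=
  fun y => if y = x then Multiplicative.ofAdd 1 else 1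

end Monoids

/-- The commutative algebra `k[Y] / ⟨R⟩` with generators `Y` and relations `R`. -/
def PresentedAlg {k : Type*} [CommRing k] {Y : Type*} (R : Set (MvPolynomial Y k)) : Type _ :=
  MvPolynomial Y k ⧸ Ideal.span R

namespace PresentedAlg

variable {k : Type*} [CommRing k] {Y : Type*} (R : Set (MvPolynomial Y k))

noncomputable instance : CommRing (PresentedAlg R) :=
  inferInstanceAs (CommRing (MvPolynomial Y k ⧸ Ideal.span R))

noncomputable instance : Algebra k (PresentedAlg R) :=
  inferInstanceAs (Algebra k (MvPolynomial Y k ⧸ Ideal.span R))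

/-- The class of the variable `y` in `k[Y] / ⟨R⟩`. -/
noncomputable def gen (y : Y) : PresentedAlg R :=
  Ideal.Quotient.mk (Ideal.span R) (MvPolynomial.X y)

end PresentedAlg

section Algebras

open MvPolynomial

/-- `F_p[V] / ⟨x^p - x | x ∈ V⟩`. -/
abbrev IdemAlg (p : ℕ) (V : Type*) : Type _ :=
  PresentedAlg (Set.range fun x : V => (X x ^ p - X x : MvPolynomial V (ZMod p)))

/-- `F_p[V] / ⟨x^p - 1 | x ∈ V⟩`. -/
abbrev ElemAlg (p : ℕ) (V : Type*) : Type _ :=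
  PresentedAlg (Set.range fun x : V => (X x ^ p - 1 : MvPolynomial V (ZMod p)))

/-- `F_p[Y] / ⟨y^p | y ∈ Y⟩`. -/
abbrev TruncAlg (p : ℕ) (Y : Type*) : Type _ :=
  PresentedAlg (Set.range fun y : Y => (X y ^ p : MvPolynomial Y (ZMod p)))

/-- `F_p[Y] / ⟨y^p - c(y) y | y ∈ Y⟩`, for scalars `c(y)`. -/
abbrev TwistAlg (p : ℕ) {Y : Type*} (c : Y → ZMod p) : Type _ :=
  PresentedAlg (Set.range fun y : Y => (X y ^ p - C (c y) * X y : MvPolynomial Y (ZMod p)))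

end Algebras

/-- The scalar `lam ^ ((ℓ(w) - 1)(p - 1))` attached to a non-empty word `w`. -/
def wordScalar {p : ℕ} {S : Type*} (lam : ZMod p) (w : List S) : ZMod p :=
  lam ^ ((w.length - 1) * (p - 1))

/-!
Let `S` be a monoid whose elements form a basis of the algebra `A`. The words over `S` form a
basis of `Sh(A)`, and every word is, in a unique way, the concatenation of a decreasing sequence
of Lyndon words, so words correspond to multisets of Lyndon words. The proof rests on two facts.

The first is a triangularity (`MixableShuffle.hasMergeLead`): with respect to the order by length
and then lexicographically, the product of two words has as its largest word the one whose
multiset of Lyndon factors is the sum of the two multisets; the coefficient is the product over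
the Lyndon words `n` of the binomial coefficients of the multiplicities of `n`. The weight does
not matter here, as the terms in which letters are multiplied are shorter. By Lucas' theorem the
binomial coefficients are units in `F_p` as long as the multiplicities are added without carry in
base `p`. Take elements `g_y` whose leading words are the elements `n^{⊗ p^i}` of `T(L)`, each
once; the monomials in them with all exponents below `p` then have as leading words all words,
each once, the exponents being the base `p` digits of the multiplicities. Hence these monomials
form a basis of `Sh(A)` (`MixableShuffle.reducedMonomials_basis`), and relations `g_y^p =
(polynomial of degree less than p)` that hold in `Sh(A)`, one for each `y`, present this algebra
(`PresentedAlg.exists_algEquiv`).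

The second is the computation of `p`-th powers from the Rota-Baxter identity: in weight zero the
`p`-th power of a non-empty word is zero (`MixableShuffle.word_pow_zero`), and in non-zero weight
it is the letterwise `p`-th power of the word (`MixableShuffle.word_pow`). The scalars `lam ^
((ℓ(w) - 1)(p - 1))` are equal to `1` for `lam ≠ 0` in `F_p`.

What remains is the choice of the elements `g_y`. In weight zero, and if all elements of `S`
satisfy `s^p = s`, they are the words in `T(L)`. For the free commutative monoid in non-zero
weight they are the same words, grouped into orbits of the letterwise `p`-th power: a non-trivial
orbit `u, u^{(p)}, u^{(p²)}, …` has relations that eliminate all variables but the one of `u`,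
which becomes free, and the fixed words are the `1^{⊗ p^i}`. For a group of exponent `p`, the
fixed words of `T(L)` are kept and the other words `w` are replaced by `w - w^{(p)}`, which have
the same leading words and `p`-th power zero.
-/

/-! ### Lyndon factorizations -/

section LyndonFactorization

variable {S : Type*} [LinearOrder S]

/-- A word below `r` either is a proper prefix of `r` or differs from it at some letter, and then
the comparison survives appending arbitrary words. -/
theorem List.lt_append_cases {x r : List S} (h : x < r) :
    (∃ r', r' ≠ [] ∧ r = x ++ r') ∨ ∀ y z, x ++ y < r ++ z := by
  induction h with
  | @nil a l => exact Or.inl ⟨a :: l, by simp, rfl⟩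
  | @rel a l b l' h => exact Or.inr fun y z => List.Lex.rel h
  | @cons a l l' h ih =>
    rcases ih with ⟨r', h1, h2⟩ | ih
    · exact Or.inl ⟨r', h1, by simp [h2]⟩
    · exact Or.inr fun y z => List.Lex.cons (ih y z)

theorem List.append_lt_append_left {x y : List S} (s : List S) (h : x < y) : s ++ x < s ++ y :=
  List.Lex.append_left _ h s

theorem List.lt_append_of_lt {x y : List S} (s : List S) (h : x < y) : x < y ++ s :=
  List.Lex.append_right _ s h

theorem List.lt_append_self {x s : List S} (hs : s ≠ []) : x < x ++ s := by
  have h : ([] : List S) < s := by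
    cases s with
    | nil => exact absurd rfl hs
    | cons a s => exact List.Lex.nil
  simpa using List.append_lt_append_left x h

theorem List.le_append_self (x s : List S) : x ≤ x ++ s := by
  by_cases hs : s = []
  · simp [hs]
  · exact (List.lt_append_self hs).le

theorem IsLyndon.lt_suffix {u v : List S} (h : IsLyndon (u ++ v)) (hu : u ≠ []) (hv : v ≠ []) :
    u ++ v < v :=
  h.2 u v hu hv rfl

theorem isLyndon_singleton (a : S) : IsLyndon [a] := by
  refine ⟨by simp, fun u v hu hv h => ?_⟩
  have := congrArg List.length h
  have := List.length_pos_of_ne_nil hu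
  have := List.length_pos_of_ne_nil hv
  simp at *
  omega

/-- A product of words not exceeding the Lyndon word `q ++ r` stays below its proper right
factor `r`. -/
theorem IsLyndon.flatten_lt_suffix {q r : List S} (h : IsLyndon (q ++ r)) (hq : q ≠ [])
    (hr : r ≠ []) {Ls : List (List S)} (hL : ∀ x ∈ Ls, x ≤ q ++ r) : Ls.flatten < r := by
  induction Ls generalizing q r with
  | nil => simpa using List.lt_append_self (x := []) hr
  | cons x Ls ih =>
    have hx : x < r := (hL x (by simp)).trans_lt (h.lt_suffix hq hr)
    rcases List.lt_append_cases hx with ⟨r', hr', rfl⟩ | hlt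
    · rw [List.flatten_cons]
      refine List.append_lt_append_left x ?_
      refine ih (q := q ++ x) (by simpa using h) (by simp [hq]) hr' fun y hy => ?_
      simpa using hL y (by simp [hy])
    · simpa using hlt Ls.flatten []

/-- Appending factors that are at most the Lyndon word `n` to a word below `n` keeps it below `n`. -/
theorem IsLyndon.append_flatten_lt {n h : List S} (hn : IsLyndon n) (hh : h ≠ []) (hlt : h < n)
    {Ls : List (List S)} (hL : ∀ x ∈ Ls, x ≤ n) : h ++ Ls.flatten < n := by
  rcases List.lt_append_cases hlt with ⟨r, hr, rfl⟩ | hlt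
  · exact List.append_lt_append_left h (hn.flatten_lt_suffix hh hr hL)
  · simpa using hlt Ls.flatten []

theorem IsLyndon.append {n m : List S} (hn : IsLyndon n) (hm : IsLyndon m) (h : n < m) :
    IsLyndon (n ++ m) := by
  refine ⟨by simp [hn.1], fun u v hu hv huv => ?_⟩
  have key : n ++ m < m := by
    rcases List.lt_append_cases h with ⟨r, hr, rfl⟩ | hlt
    · exact List.append_lt_append_left n (hm.lt_suffix hn.1 hr)
    · simpa using hlt m []
  change n ++ m < v
  rcases List.append_eq_append_iff.1 huv with ⟨a', rfl, rfl⟩ | ⟨c', rfl, rfl⟩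
  · by_cases ha : a' = []
    · subst ha; simpa using key
    · exact key.trans (hm.lt_suffix ha hv)
  · by_cases hc : c' = []
    · subst hc; simpa using key
    · have h1 := hn.lt_suffix hu hc
      rcases List.lt_append_cases h1 with ⟨r, hr, h2⟩ | hlt
      · have := congrArg List.length h2
        have := List.length_pos_of_ne_nil hu
        have := List.length_pos_of_ne_nil hr
        simp at *
        omega
      · exact hlt m m

variable (S) in
/-- The type of Lyndon words over `S`, ordered lexicographically. -/
abbrev LyndonWord : Type _ := {w : List S // IsLyndon w}

namespace LyndonWord

/-- The concatenation of a list of Lyndon words. -/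
def join (L : List (LyndonWord S)) : List S := (L.map Subtype.val).flatten

@[simp] theorem join_nil : join ([] : List (LyndonWord S)) = [] := rfl

@[simp] theorem join_cons (n : LyndonWord S) (L : List (LyndonWord S)) :
    join (n :: L) = n.1 ++ join L := rfl

theorem join_append (L M : List (LyndonWord S)) : join (L ++ M) = join L ++ join M := by
  simp [join]

theorem append_join_lt {n : LyndonWord S} {h : List S} (hh : h ≠ []) (hlt : h < n.1)
    {L : List (LyndonWord S)} (hL : ∀ x ∈ L, x ≤ n) : h ++ join L < n.1 := by
  refine n.2.append_flatten_lt hh hlt fun x hx => ?_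
  obtain ⟨y, hy, rfl⟩ := List.mem_map.1 hx
  exact hL y hy

/-- On decreasing lists of Lyndon words, concatenation is strictly increasing. -/
theorem join_lt_join {L M : List (LyndonWord S)} (hL : L.Pairwise (· ≥ ·)) (h : L < M) :
    join L < join M := by
  induction h with
  | @nil a l =>
    have := List.lt_append_self (x := []) (s := join (a :: l)) (by simp [a.2.1])
    simpa using this
  | @rel a l b l' h =>
    rw [List.pairwise_cons] at hL
    exact List.lt_append_of_lt _
      (append_join_lt a.2.1 h fun x hx => (hL.1 x hx).trans h.le)
  | @cons a l l' h ih =>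
    exact List.append_lt_append_left _ (ih (List.pairwise_cons.1 hL).2)

theorem join_lt_join_iff {L M : List (LyndonWord S)} (hL : L.Pairwise (· ≥ ·))
    (hM : M.Pairwise (· ≥ ·)) : join L < join M ↔ L < M := by
  refine ⟨fun h => ?_, join_lt_join hL⟩
  by_contra hn
  rcases (not_lt.1 hn).eq_or_lt with rfl | h'
  · exact lt_irrefl _ h
  · exact lt_asymm h (join_lt_join hM h')

theorem exists_sorted_append (n : LyndonWord S) (M : List (LyndonWord S))
    (hM : M.Pairwise (· ≥ ·)) :
    ∃ L : List (LyndonWord S), L.Pairwise (· ≥ ·) ∧ join L = n.1 ++ join M := by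
  induction M generalizing n with
  | nil => exact ⟨[n], by simp, by simp⟩
  | cons m M ih =>
    rcases le_or_gt m n with h | h
    · refine ⟨n :: m :: M, ?_, rfl⟩
      rw [List.pairwise_cons] at hM
      refine List.pairwise_cons.2 ⟨fun x hx => ?_, List.pairwise_cons.2 hM⟩
      rcases List.mem_cons.1 hx with rfl | hx
      · exact h
      · exact (hM.1 x hx).trans h
    · obtain ⟨L, h1, h2⟩ := ih ⟨n.1 ++ m.1, n.2.append m.2 h⟩ (List.pairwise_cons.1 hM).2
      exact ⟨L, h1, by simpa using h2⟩

/-- Existence of the Chen-Fox-Lyndon factorization. -/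
theorem exists_sorted (w : List S) :
    ∃ L : List (LyndonWord S), L.Pairwise (· ≥ ·) ∧ join L = w := by
  induction w with
  | nil => exact ⟨[], by simp, rfl⟩
  | cons a w ih =>
    obtain ⟨M, h1, rfl⟩ := ih
    exact exists_sorted_append ⟨[a], isLyndon_singleton a⟩ M h1

/-- The decreasing concatenation of a multiset of Lyndon words. -/
def wd (M : Multiset (LyndonWord S)) : List S := join (M.sort (· ≥ ·))

theorem wd_coe {L : List (LyndonWord S)} (hL : L.Pairwise (· ≥ ·)) : wd (L : Multiset _) = join L := by
  unfold wd
  congr 1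
  exact List.Perm.eq_of_pairwise' (r := (· ≥ ·)) (Multiset.pairwise_sort _ _) hL
    (Multiset.coe_eq_coe.1 (Multiset.sort_eq _ _))

@[simp] theorem wd_zero : wd (0 : Multiset (LyndonWord S)) = [] := by simp [wd]

theorem wd_cons {n : LyndonWord S} {M : Multiset (LyndonWord S)} (h : ∀ m ∈ M, m ≤ n) :
    wd (n ::ₘ M) = n.1 ++ wd M := by
  rw [wd, Multiset.sort_cons n M (· ≥ ·) h]
  rfl

/-- Uniqueness of the Chen-Fox-Lyndon factorization. -/
theorem wd_injective : Function.Injective (wd : Multiset (LyndonWord S) → List S) := by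
  intro M N h
  have h1 := Multiset.pairwise_sort M (· ≥ ·)
  have h2 := Multiset.pairwise_sort N (· ≥ ·)
  rw [← Multiset.sort_eq M (· ≥ ·), ← Multiset.sort_eq N (· ≥ ·)]
  congr 1
  by_contra hne
  rcases lt_or_gt_of_ne hne with h' | h'
  · exact (join_lt_join h1 h').ne h
  · exact (join_lt_join h2 h').ne h.symm

theorem wd_surjective : Function.Surjective (wd : Multiset (LyndonWord S) → List S) := by
  intro w
  obtain ⟨L, h1, h2⟩ := exists_sorted w
  exact ⟨L, by rw [wd_coe h1, h2]⟩

/-- The multiset of Lyndon factors in the Chen-Fox-Lyndon factorization of a word. -/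
noncomputable def cfl : List S ≃ Multiset (LyndonWord S) :=
  (Equiv.ofBijective wd ⟨wd_injective, wd_surjective⟩).symm

@[simp] theorem wd_cfl (w : List S) : wd (cfl w) = w :=
  (Equiv.ofBijective wd ⟨wd_injective, wd_surjective⟩).apply_symm_apply w

@[simp] theorem cfl_wd (M : Multiset (LyndonWord S)) : cfl (wd M) = M :=
  (Equiv.ofBijective wd ⟨wd_injective, wd_surjective⟩).symm_apply_apply M

theorem length_wd (M : Multiset (LyndonWord S)) :
    (wd M).length = (M.map fun n => n.1.length).sum := by
  have h : (M.map fun n => n.1.length) =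
      (((M.sort (· ≥ ·)).map fun n => n.1.length : List ℕ) : Multiset ℕ) := by
    rw [← Multiset.map_coe, Multiset.sort_eq]
  rw [h, Multiset.sum_coe, wd, join, List.length_flatten, List.map_map]
  rfl

theorem exists_max {M : Multiset (LyndonWord S)} (hM : M ≠ 0) : ∃ n ∈ M, ∀ m ∈ M, m ≤ n := by
  obtain ⟨n, hn⟩ := Multiset.exists_mem_of_ne_zero hM
  obtain ⟨x, h1, h2⟩ := M.toFinset.exists_max_image id ⟨n, by simpa using hn⟩
  exact ⟨x, by simpa using h1, fun m hm => h2 m (by simpa using hm)⟩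

/-- All Lyndon factors of the tail of a Lyndon word exceed that word. -/
theorem lt_of_mem_cfl_tail {n : LyndonWord S} {a : S} {t : List S} (h : n.1 = a :: t)
    {m : LyndonWord S} (hm : m ∈ cfl t) : n < m := by
  obtain ⟨L, hL, rfl⟩ := exists_sorted t
  rw [← wd_coe hL, cfl_wd, Multiset.mem_coe] at hm
  have hne : L ≠ [] := List.ne_nil_of_mem hm
  obtain ⟨L', x, rfl⟩ := List.eq_nil_or_concat L |>.resolve_left hne
  rw [List.concat_eq_append] at *
  have hx : x ≤ m := by
    rcases List.mem_append.1 hm with hm | hm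
    · exact (List.pairwise_append.1 hL).2.2 m hm x (by simp)
    · rw [List.mem_singleton.1 hm]
  refine lt_of_lt_of_le ?_ hx
  refine n.2.2 (a :: join L') x.1 (by simp) x.2.1 ?_
  simp [h, join_append]

theorem wd_add {P Q : Multiset (LyndonWord S)} (h : ∀ x ∈ P, ∀ y ∈ Q, y ≤ x) :
    wd (P + Q) = wd P ++ wd Q := by
  obtain ⟨L, hL, hP⟩ := exists_sorted (wd P)
  obtain ⟨M, hM, hQ⟩ := exists_sorted (wd Q)
  rw [← wd_coe hL] at hP
  rw [← wd_coe hM] at hQ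
  obtain rfl := wd_injective hP
  obtain rfl := wd_injective hQ
  rw [Multiset.coe_add, wd_coe hL, wd_coe hM, ← join_append, wd_coe]
  exact List.pairwise_append.2 ⟨hL, hM, fun x hx y hy => h x (by simpa using hx) y (by simpa using hy)⟩

/-- Deleting the first letter of a word affects only its first (largest) Lyndon factor. -/
theorem cfl_cons (a : S) (u : List S) : ∃ (n : LyndonWord S) (t : List S)
    (M : Multiset (LyndonWord S)), n.1 = a :: t ∧ cfl (a :: u) = n ::ₘ M ∧ (∀ m ∈ M, m ≤ n) ∧
      cfl u = cfl t + M := by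
  have hne : cfl (a :: u) ≠ 0 := by
    intro h
    have := wd_cfl (a :: u)
    simp [h] at this
  obtain ⟨n, hn, hmax⟩ := exists_max hne
  obtain ⟨M, hM⟩ := Multiset.exists_cons_of_mem hn
  have hM' : ∀ m ∈ M, m ≤ n := fun m hm => hmax m (by simp [hM, hm])
  have h1 : a :: u = n.1 ++ wd M := by rw [← wd_cons hM', ← hM, wd_cfl]
  obtain ⟨b, t, hbt⟩ := List.exists_cons_of_ne_nil n.2.1
  rw [hbt, List.cons_append, List.cons.injEq] at h1
  obtain ⟨rfl, rfl⟩ := h1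
  refine ⟨n, t, M, hbt, hM, hM', ?_⟩
  refine wd_injective ?_
  rw [wd_cfl, wd_add, wd_cfl]
  exact fun x hx y hy => (hM' y hy).trans (lt_of_mem_cfl_tail hbt hx).le

/-- Comparison of the two ways to begin a shuffle: removing the first letter `b` from a Lyndon
factor `b :: t` smaller than the largest factor `n` gives a smaller word. -/
theorem cons_wd_lt {M : Multiset (LyndonWord S)} {n n' : LyndonWord S} (hn : n ∈ M)
    (hM : ∀ m ∈ M, m ≤ n) (h' : n' < n) {b : S} {t : List S} (hbt : n'.1 = b :: t) :
    b :: wd (M + cfl t) < wd (n' ::ₘ M) := by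
  have hlarge : n.1 ≤ wd (n' ::ₘ M) := by
    obtain ⟨M', rfl⟩ := Multiset.exists_cons_of_mem hn
    rw [Multiset.cons_swap, wd_cons]
    · exact List.le_append_self _ _
    · intro m hm
      rcases Multiset.mem_cons.1 hm with rfl | hm
      · exact h'.le
      · exact hM m (by simp [hm])
  refine lt_of_lt_of_le ?_ hlarge
  obtain ⟨T, hT, rfl⟩ := exists_sorted t
  rw [← wd_coe hT, cfl_wd]
  -- the factors of the tail above `n` come first in the decreasing concatenation; the others, like
  -- those of `M`, are at most `n`
  have hsplit : T = T.takeWhile (n < ·) ++ T.dropWhile (n < ·) :=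
    (List.takeWhile_append_dropWhile).symm
  set T₁ := T.takeWhile (n < ·) with hT₁
  set T₂ := T.dropWhile (n < ·) with hT₂
  have h1 : ∀ x ∈ T₁, n < x := fun x hx => by simpa using List.mem_takeWhile_imp hx
  have h2 : ∀ x ∈ T₂, x ≤ n := by
    intro x hx
    have hpos : 0 < T₂.length := List.length_pos_of_mem hx
    have h0 : ¬ n < T₂[0] := by
      have := List.dropWhile_get_zero_not (fun y => decide (n < y)) T hpos
      simpa using this
    have hs : T₂.Pairwise (· ≥ ·) := hT.sublist (List.dropWhile_sublist _)
    obtain ⟨i, hi, rfl⟩ := List.getElem_of_mem hx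
    rcases Nat.eq_zero_or_pos i with rfl | hi0
    · exact not_lt.1 h0
    · exact (List.pairwise_iff_getElem.1 hs 0 i hpos hi hi0).trans (not_lt.1 h0)
  have hT₁s : T₁.Pairwise (· ≥ ·) := hT.sublist (List.takeWhile_sublist _)
  have hdecomp : wd (M + (T : Multiset _)) = join T₁ ++ wd (M + (T₂ : Multiset _)) := by
    rw [hsplit, ← Multiset.coe_add, add_left_comm]
    generalize hN : M + (T₂ : Multiset (LyndonWord S)) = N
    have hNle : ∀ x ∈ N, x ≤ n := by
      intro x hx
      rw [← hN, Multiset.mem_add] at hx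
      exact hx.elim (hM x) (h2 x)
    clear_value T₁
    clear hT₁ hsplit
    induction T₁ with
    | nil => simp
    | cons y T₁ ih =>
      rw [List.pairwise_cons] at hT₁s
      rw [← Multiset.cons_coe, Multiset.cons_add, wd_cons, ih (fun x hx => h1 x (by simp [hx])) hT₁s.2]
      · simp
      · intro x hx
        rcases Multiset.mem_add.1 hx with hx | hx
        · exact hT₁s.1 x hx
        · exact (hNle x hx).trans (h1 y (by simp)).le
  rw [hdecomp]
  have hlt : b :: join T₁ < n.1 := by
    refine lt_of_le_of_lt ?_ h'
    change b :: join T₁ ≤ n'.1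
    rw [hbt, hsplit, join_append]
    exact List.le_append_self (b :: join T₁) _
  refine append_join_lt (h := b :: join T₁) (by simp) hlt fun x hx => ?_
  rw [Multiset.mem_sort, Multiset.mem_add] at hx
  exact hx.elim (hM x) (h2 x)

theorem sort_cons_eq_orderedInsert (n : LyndonWord S) (M : Multiset (LyndonWord S)) :
    (n ::ₘ M).sort (· ≥ ·) = (M.sort (· ≥ ·)).orderedInsert (· ≥ ·) n := by
  refine List.Perm.eq_of_pairwise' (r := (· ≥ ·)) (Multiset.pairwise_sort _ _)
    (List.Pairwise.orderedInsert n _ (Multiset.pairwise_sort _ _)) ?_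
  rw [← Multiset.coe_eq_coe, Multiset.sort_eq]
  rw [Multiset.coe_eq_coe.2 (List.perm_orderedInsert _ _ _), ← Multiset.cons_coe, Multiset.sort_eq]

theorem orderedInsert_lt {α : Type*} [LinearOrder α] (n : α) {L M : List α} (h : L < M) :
    L.orderedInsert (· ≥ ·) n < M.orderedInsert (· ≥ ·) n := by
  induction h with
  | @nil a l =>
    rw [List.orderedInsert_cons]
    split_ifs with h
    · exact List.Lex.cons List.Lex.nil
    · exact List.Lex.rel (not_le.1 h)
  | @rel a l b l' h =>
    rw [List.orderedInsert_cons, List.orderedInsert_cons]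
    split_ifs with h1 h2 h2
    · exact List.Lex.cons (List.Lex.rel h)
    · exact List.Lex.rel (not_le.1 h2)
    · exact absurd (h.le.trans h2) h1
    · exact List.Lex.rel h
  | @cons a l l' h ih =>
    rw [List.orderedInsert_cons, List.orderedInsert_cons]
    split_ifs with h1
    · exact List.Lex.cons (List.Lex.cons h)
    · exact List.Lex.cons ih

theorem wd_cons_lt (n : LyndonWord S) {M N : Multiset (LyndonWord S)} (h : wd M < wd N) :
    wd (n ::ₘ M) < wd (n ::ₘ N) := by
  unfold wd at h ⊢
  rw [join_lt_join_iff (Multiset.pairwise_sort _ _) (Multiset.pairwise_sort _ _)] at h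
  refine join_lt_join (Multiset.pairwise_sort _ _) ?_
  rw [sort_cons_eq_orderedInsert, sort_cons_eq_orderedInsert]
  exact orderedInsert_lt n h

/-- Adding Lyndon factors preserves the shortlex order of the words of multisets. -/
theorem shortlex_wd_add {M N : Multiset (LyndonWord S)}
    (h : List.Shortlex (· < ·) (wd M) (wd N)) (K : Multiset (LyndonWord S)) :
    List.Shortlex (· < ·) (wd (M + K)) (wd (N + K)) := by
  rw [List.shortlex_def] at h ⊢
  simp only [length_wd, Multiset.map_add, Multiset.sum_add] at h ⊢
  refine h.imp (by simp) fun h => ⟨by simp [h.1], ?_⟩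
  have h2 : wd M < wd N := h.2
  clear h
  change wd (M + K) < wd (N + K)
  induction K using Multiset.induction_on with
  | empty => simpa using h2
  | cons n K ih =>
    rw [Multiset.add_cons, Multiset.add_cons]
    exact wd_cons_lt n ih

end LyndonWord

end LyndonFactorization

/-! ### Leading words of mixable shuffle products -/

section LeadingWords

namespace LyndonWord

variable {S : Type*} [LinearOrder S]

/-- The coefficient with which the largest word `wd (M + N)` occurs in the shuffle product of the
words `wd M` and `wd N`. -/
def mult (M N : Multiset (LyndonWord S)) : ℕ :=
  ∏ n ∈ M.toFinset, (M.count n + N.count n).choose (M.count n)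

theorem mult_eq_prod {M N : Multiset (LyndonWord S)} {s : Finset (LyndonWord S)}
    (hs : ∀ n ∈ M, n ∈ N → n ∈ s) :
    mult M N = ∏ n ∈ s, (M.count n + N.count n).choose (M.count n) := by
  have key : ∀ n, n ∉ M ∨ n ∉ N → (M.count n + N.count n).choose (M.count n) = 1 := by
    rintro n (h | h) <;> simp [Multiset.count_eq_zero_of_notMem h]
  rw [mult, ← Finset.prod_subset (Finset.inter_subset_left (s₂ := s)),
    Finset.prod_subset (Finset.inter_subset_right (s₁ := M.toFinset))]
  · intro n h1 h2
    exact key n (Or.inl fun h => h2 (by simp [h, h1]))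
  · intro n h1 h2
    exact key n (Or.inr fun h => h2 (by simpa [h1] using hs n (by simpa using h1) h))

theorem mult_comm (M N : Multiset (LyndonWord S)) : mult M N = mult N M := by
  rw [mult_eq_prod (s := N.toFinset) (by simp), mult]
  refine Finset.prod_congr rfl fun n _ => ?_
  rw [add_comm, Nat.choose_symm_add]

@[simp] theorem mult_zero_left (M : Multiset (LyndonWord S)) : mult 0 M = 1 := by simp [mult]

/-- Removing the first letter of the first factor `n`, which replaces `n` by the factors `C` of its
tail, does not change the multiplicity if `n` exceeds all factors of the other word. -/
theorem mult_cons_of_lt {n : LyndonWord S} {M N C : Multiset (LyndonWord S)}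
    (hN : ∀ m ∈ N, m < n) (hC : ∀ m ∈ C, n < m) : mult (n ::ₘ M) N = mult (C + M) N := by
  rw [mult_eq_prod (s := N.toFinset) (by simp), mult_eq_prod (s := N.toFinset) (by simp)]
  refine Finset.prod_congr rfl fun m hm => ?_
  have h1 : m < n := hN m (by simpa using hm)
  have h2 : m ∉ C := fun h => lt_asymm h1 (hC m h)
  rw [Multiset.count_cons_of_ne h1.ne, Multiset.count_add, Multiset.count_eq_zero_of_notMem h2,
    zero_add]

/-- Pascal's rule for the multiplicities, when both words have the same largest factor `n` and `C` are
the factors of the tail of `n`. -/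
theorem mult_cons_cons {n : LyndonWord S} {M N C : Multiset (LyndonWord S)}
    (hM : ∀ m ∈ M, m ≤ n) (hN : ∀ m ∈ N, m ≤ n) (hC : ∀ m ∈ C, n < m) :
    mult (n ::ₘ M) (n ::ₘ N) = mult (C + M) (n ::ₘ N) + mult (n ::ₘ M) (C + N) := by
  have hnC : n ∉ C := fun h => lt_irrefl _ (hC n h)
  set s := (M ∩ N).toFinset.erase n with hs
  have hlt : ∀ m ∈ s, m < n := fun m hm => by
    simp only [hs, Finset.mem_erase, Multiset.mem_toFinset, Multiset.mem_inter] at hm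
    exact (hM m hm.2.1).lt_of_ne hm.1
  have hns : n ∉ s := by simp [hs]
  have hsC : ∀ m ∈ s, m ∉ C := fun m hm h => lt_asymm (hlt m hm) (hC m h)
  have mem : ∀ m, (m = n ∨ m ∈ M) → (m = n ∨ m ∈ N) → m ∈ insert n s := by
    intro m h1 h2
    by_cases h : m = n
    · simp [h]
    · simp [hs, h, h1.resolve_left h, h2.resolve_left h]
  rw [mult_eq_prod (s := insert n s) (by simpa using mem),
    mult_eq_prod (M := C + M) (s := insert n s), mult_eq_prod (N := C + N) (s := insert n s),
    Finset.prod_insert hns, Finset.prod_insert hns, Finset.prod_insert hns]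
  · have e1 : ∏ m ∈ s, ((C + M).count m + (n ::ₘ N).count m).choose ((C + M).count m) =
        ∏ m ∈ s, ((n ::ₘ M).count m + (n ::ₘ N).count m).choose ((n ::ₘ M).count m) := by
      refine Finset.prod_congr rfl fun m hm => ?_
      simp [Multiset.count_eq_zero_of_notMem (hsC m hm), Multiset.count_cons_of_ne (hlt m hm).ne]
    have e2 : ∏ m ∈ s, ((n ::ₘ M).count m + (C + N).count m).choose ((n ::ₘ M).count m) =
        ∏ m ∈ s, ((n ::ₘ M).count m + (n ::ₘ N).count m).choose ((n ::ₘ M).count m) := by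
      refine Finset.prod_congr rfl fun m hm => ?_
      simp [Multiset.count_eq_zero_of_notMem (hsC m hm), Multiset.count_cons_of_ne (hlt m hm).ne]
    rw [e1, e2, ← add_mul]
    congr 1
    simp only [Multiset.count_cons_self, Multiset.count_add,
      Multiset.count_eq_zero_of_notMem hnC, zero_add]
    rw [show M.count n + 1 + (N.count n + 1) = (M.count n + (N.count n + 1)) + 1 by ring,
      Nat.choose_succ_succ]
    congr 2
    ring
  · intro m h1 h2
    rw [Multiset.mem_cons] at h1
    rw [Multiset.mem_add] at h2
    refine mem m h1 (h2.imp_left fun h => ?_)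
    exfalso
    rcases h1 with rfl | h1
    · exact hnC h
    · exact ((hM m h1).trans_lt (hC m h)).false
  · intro m h1 h2
    rw [Multiset.mem_cons] at h2
    rw [Multiset.mem_add] at h1
    refine mem m (h1.imp_left fun h => ?_) h2
    exfalso
    rcases h2 with rfl | h2
    · exact hnC h
    · exact ((hN m h2).trans_lt (hC m h)).false

end LyndonWord

namespace MixableShuffle

variable {k : Type*} [CommRing k] (lam : k) {A : Type*} [CommRing A] [Algebra k A]

/-- The operator `x ↦ a ⊗ x` on the mixable shuffle algebra. -/
noncomputable def prepend (a : A) : MixableShuffle k lam A →ₗ[k] MixableShuffle k lam A :=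
  LinearMap.mulLeft k (A := TensorAlgebra k A) (TensorAlgebra.ι k a)

theorem prepend_mul_prepend (a b : A) (x y : MixableShuffle k lam A) :
    prepend lam a x * prepend lam b y = prepend lam a (x * prepend lam b y) +
      prepend lam b (prepend lam a x * y) + lam • prepend lam (a * b) (x * y) :=
  product_cons_cons lam a b x y

variable {S : Type*}

@[simp] theorem word_nil (f : S → A) : word lam f [] = 1 := rfl

@[simp] theorem word_cons (f : S → A) (a : S) (w : List S) :
    word lam f (a :: w) = prepend lam (f a) (word lam f w) := by
  simp only [word, List.map_cons, List.prod_cons]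
  rfl

variable [LinearOrder S] (f : S → A)

/-- The span of the words that precede `w` in the shortlex order: shorter words, and words of the same
length that are lexicographically smaller. -/
noncomputable def below (w : List S) : Submodule k (MixableShuffle k lam A) :=
  Submodule.span k (word lam f '' {u | List.Shortlex (· < ·) u w})

variable {lam f}

theorem shortlex_trans {u v w : List S} (h : List.Shortlex (· < ·) u v)
    (h' : List.Shortlex (· < ·) v w) : List.Shortlex (· < ·) u w := by
  rw [List.shortlex_def] at *
  rcases h with h | ⟨h, h1⟩ <;> rcases h' with h' | ⟨h', h2⟩
  · exact Or.inl (h.trans h')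
  · exact Or.inl (h.trans_eq h')
  · exact Or.inl (h.trans_lt h')
  · exact Or.inr ⟨h.trans h', lt_trans (show u < v from h1) h2⟩

theorem word_mem_below {u w : List S} (h : List.Shortlex (· < ·) u w) :
    word lam f u ∈ below lam f w :=
  Submodule.subset_span ⟨u, h, rfl⟩

theorem below_mono {u w : List S} (h : List.Shortlex (· < ·) u w) :
    below lam f u ≤ below lam f w := by
  refine Submodule.span_mono (Set.image_mono fun v hv => shortlex_trans hv h)

theorem prepend_mem_below {w : List S} {x : MixableShuffle k lam A} (a : S)
    (hx : x ∈ below lam f w) : prepend lam (f a) x ∈ below lam f (a :: w) := by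
  have : below lam f w ≤ (below lam f (a :: w)).comap (prepend lam (f a)) := by
    refine Submodule.span_le.2 ?_
    rintro _ ⟨u, hu, rfl⟩
    change prepend lam (f a) (word lam f u) ∈ below lam f (a :: w)
    rw [← word_cons]
    exact word_mem_below (List.Shortlex.cons hu)
  exact this hx

theorem mem_below_of_sub {u w : List S} {x : MixableShuffle k lam A} {c : k}
    (h : x - c • word lam f u ∈ below lam f u) (huw : List.Shortlex (· < ·) u w) :
    x ∈ below lam f w := by
  have := add_mem (below_mono huw h) (Submodule.smul_mem _ c (word_mem_below (lam := lam) (f := f) huw))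
  simpa using this

open LyndonWord

variable (lam f) in
/-- The product of the words `u` and `v` is `mult (cfl u) (cfl v)` times the word obtained by merging
their Lyndon factorizations, up to smaller words. -/
def HasMergeLead (u v : List S) : Prop :=
  word lam f u * word lam f v - (mult (cfl u) (cfl v) : k) • word lam f (wd (cfl u + cfl v)) ∈
    below lam f (wd (cfl u + cfl v))

theorem HasMergeLead.symm {u v : List S} (h : HasMergeLead lam f u v) : HasMergeLead lam f v u := by
  unfold HasMergeLead at *
  rwa [mul_comm, mult_comm, add_comm]

theorem length_wd_cfl_add (u v : List S) : (wd (cfl u + cfl v)).length = u.length + v.length := by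
  rw [length_wd, Multiset.map_add, Multiset.sum_add, ← length_wd, ← length_wd, wd_cfl, wd_cfl]

theorem cfl_nil : cfl ([] : List S) = 0 := by rw [← wd_zero, cfl_wd]

theorem hasMergeLead_nil_left (v : List S) : HasMergeLead lam f [] v := by
  simp [HasMergeLead, cfl_nil]

/-- The recursion for the product of `a :: u` and `b :: v`, whose largest factors are `n = a :: t` and
`n' = b :: t'` with `n' ≤ n`. The terms beginning with `a` contribute the leading word; those beginning
with `b` do so only if `n' = n`, and the terms beginning with `a * b` are shorter. -/
theorem HasMergeLead.step [CommMonoid S] (hf : ∀ s t, f (s * t) = f s * f t)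
    {a b : S} {u v : List S} (h1 : HasMergeLead lam f u (b :: v))
    (h2 : HasMergeLead lam f (a :: u) v) (h3 : HasMergeLead lam f u v)
    {n n' : LyndonWord S} {t t' : List S} {M M' : Multiset (LyndonWord S)}
    (hn : n.1 = a :: t) (hn' : n'.1 = b :: t')
    (hu : cfl (a :: u) = n ::ₘ M) (hv : cfl (b :: v) = n' ::ₘ M')
    (hM : ∀ m ∈ M, m ≤ n) (hM' : ∀ m ∈ M', m ≤ n')
    (hu' : cfl u = cfl t + M) (hv' : cfl v = cfl t' + M') (hle : n' ≤ n) :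
    HasMergeLead lam f (a :: u) (b :: v) := by
  have hC : ∀ m ∈ cfl t, n < m := fun m hm => lt_of_mem_cfl_tail hn hm
  unfold HasMergeLead at h1 h2 ⊢
  set W := wd (cfl (a :: u) + cfl (b :: v)) with hW
  have hWlen : W.length = u.length + v.length + 2 := by
    rw [hW, length_wd_cfl_add]; simp; ring
  have hrest : ∀ m ∈ M + n' ::ₘ M', m ≤ n := by
    intro m hm
    rw [Multiset.mem_add, Multiset.mem_cons] at hm
    rcases hm with hm | rfl | hm
    · exact hM m hm
    · exact hle
    · exact (hM' m hm).trans hle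
  have hW1 : W = a :: wd (cfl u + cfl (b :: v)) := by
    rw [hW, hu, hv, hu', Multiset.cons_add, wd_cons hrest, add_assoc,
      wd_add (P := cfl t), wd_cfl, hn]
    · rfl
    · exact fun x hx y hy => (hrest y hy).trans (hC x hx).le
  -- the part of the product beginning with `a`
  have t1 : prepend lam (f a) (word lam f u * word lam f (b :: v)) -
      (mult (cfl u) (cfl (b :: v)) : k) • word lam f W ∈ below lam f W := by
    have := prepend_mem_below a h1
    rwa [map_sub, map_smul, ← word_cons, ← hW1] at this
  -- the part of the product beginning with `a * b`
  have t3 : lam • prepend lam (f a * f b) (word lam f u * word lam f v) ∈ below lam f W := by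
    refine Submodule.smul_mem _ _ ?_
    rw [← hf]
    have hl : (wd (cfl u + cfl v)).length = u.length + v.length := length_wd_cfl_add u v
    have h4 := prepend_mem_below (a * b) h3
    rw [map_sub, map_smul, ← word_cons] at h4
    exact mem_below_of_sub h4 (List.Shortlex.of_length_lt (by simp [hl, hWlen]))
  have h2' := prepend_mem_below b h2
  rw [map_sub, map_smul, ← word_cons] at h2'
  rw [word_cons lam f a u, word_cons lam f b v, prepend_mul_prepend, ← word_cons lam f a u,
    ← word_cons lam f b v]
  rcases hle.lt_or_eq with hlt | rfl
  -- if `n' < n`, the terms beginning with `b` are smaller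
  · have t2 : prepend lam (f b) (word lam f (a :: u) * word lam f v) ∈ below lam f W := by
      refine mem_below_of_sub h2' (List.Shortlex.of_lex ?_ ?_)
      · rw [List.length_cons, length_wd_cfl_add, hWlen]; simp; ring
      · rw [hW, hv, hv', Multiset.add_cons, add_left_comm, add_comm (cfl t')]
        refine cons_wd_lt (n := n) ?_ ?_ hlt hn'
        · simp [hu]
        · intro m hm
          rw [hu, Multiset.mem_add, Multiset.mem_cons] at hm
          rcases hm with (rfl | hm) | hm
          · exact le_rfl
          · exact hM m hm
          · exact (hM' m hm).trans hle
    have hmult : mult (cfl (a :: u)) (cfl (b :: v)) = mult (cfl u) (cfl (b :: v)) := by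
      rw [hu, hu', hv]
      refine mult_cons_of_lt (fun m hm => ?_) hC
      rcases Multiset.mem_cons.1 hm with rfl | hm
      · exact hlt
      · exact (hM' m hm).trans_lt hlt
    rw [hmult]
    convert add_mem (add_mem t1 t2) t3 using 1
    abel
  -- if `n' = n`, they have the same leading word, and the coefficients add up by Pascal's rule
  · obtain ⟨rfl, rfl⟩ : a = b ∧ t = t' := by simpa [hn] using hn'
    have hW2 : W = a :: wd (cfl (a :: u) + cfl v) := by
      rw [hW1]
      congr 2
      rw [hu', hv', hu, hv]
      simp only [Multiset.add_cons, Multiset.cons_add]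
      congr 1
      abel
    rw [← hW2] at h2'
    have hmult : mult (cfl (a :: u)) (cfl (a :: v)) =
        mult (cfl u) (cfl (a :: v)) + mult (cfl (a :: u)) (cfl v) := by
      rw [hu, hu', hv, hv']
      exact mult_cons_cons hM hM' hC
    rw [hmult, Nat.cast_add, add_smul]
    convert add_mem (add_mem t1 h2') t3 using 1
    abel

theorem hasMergeLead [CommMonoid S] (hf : ∀ s t, f (s * t) = f s * f t) (u v : List S) :
    HasMergeLead lam f u v := by
  induction hN : u.length + v.length using Nat.strong_induction_on generalizing u v with
  | _ N ih =>
  subst hN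
  rcases u with _ | ⟨a, u⟩
  · exact hasMergeLead_nil_left v
  rcases v with _ | ⟨b, v⟩
  · exact (hasMergeLead_nil_left _).symm
  have h1 := ih _ (by simp) u (b :: v) rfl
  have h2 := ih _ (by simp) (a :: u) v rfl
  have h3 := ih _ (by simp; omega) u v rfl
  obtain ⟨n, t, M, e1, e2, e3, e4⟩ := cfl_cons a u
  obtain ⟨n', t', M', e1', e2', e3', e4'⟩ := cfl_cons b v
  rcases le_total n' n with h | h
  · exact HasMergeLead.step hf h1 h2 h3 e1 e1' e2 e2' e3 e3' e4 e4' h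
  · exact (HasMergeLead.step hf h2.symm h1.symm h3.symm e1' e1 e2' e2 e3' e3 e4' e4 h).symm

variable (f) in
/-- `x` is `c` times the word with Lyndon factors `M`, up to smaller words. -/
def HasLead (x : MixableShuffle k lam A) (c : k) (M : Multiset (LyndonWord S)) : Prop :=
  x - c • word lam f (wd M) ∈ below lam f (wd M)

theorem shortlex_wd_cfl_add {u : List S} {M : Multiset (LyndonWord S)}
    (h : List.Shortlex (· < ·) u (wd M)) (K : Multiset (LyndonWord S)) :
    List.Shortlex (· < ·) (wd (cfl u + K)) (wd (M + K)) :=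
  shortlex_wd_add (by rwa [wd_cfl]) K

theorem hasLead_one : HasLead f (1 : MixableShuffle k lam A) 1 0 := by
  simp [HasLead]

theorem hasLead_word (w : List S) : HasLead f (word lam f w) 1 (cfl w) := by
  simp [HasLead]

/-- Leading words multiply by merging their Lyndon factors. -/
theorem HasLead.mul [CommMonoid S] (hf : ∀ s t, f (s * t) = f s * f t)
    {x y : MixableShuffle k lam A} {c d : k} {M N : Multiset (LyndonWord S)}
    (hx : HasLead f x c M) (hy : HasLead f y d N) :
    HasLead f (x * y) (c * d * mult M N) (M + N) := by
  have hww : ∀ {u v : List S}, List.Shortlex (· < ·) (wd (cfl u + cfl v)) (wd (M + N)) →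
      word lam f u * word lam f v ∈ below lam f (wd (M + N)) := fun h =>
    mem_below_of_sub (hasMergeLead hf _ _) h
  have hxw : ∀ {x}, x ∈ below lam f (wd M) →
      x * word lam f (wd N) ∈ below lam f (wd (M + N)) := by
    intro x hx
    induction hx using Submodule.span_induction with
    | mem x hx =>
      obtain ⟨u, hu, rfl⟩ := hx
      exact hww (by simpa using shortlex_wd_cfl_add hu N)
    | zero => simp
    | add x y _ _ h1 h2 => rw [add_mul]; exact add_mem h1 h2
    | smul c x _ h1 => rw [smul_mul_assoc]; exact Submodule.smul_mem _ _ h1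
  have hyx : ∀ {u y}, (u = wd M ∨ List.Shortlex (· < ·) u (wd M)) → y ∈ below lam f (wd N) →
      word lam f u * y ∈ below lam f (wd (M + N)) := by
    intro u y hu hy
    induction hy using Submodule.span_induction with
    | mem y hy =>
      obtain ⟨v, hv, rfl⟩ := hy
      have h1 := shortlex_wd_cfl_add hv (cfl u)
      rw [add_comm (cfl v), add_comm N] at h1
      rcases hu with rfl | hu
      · exact hww (by simpa using h1)
      · exact hww (shortlex_trans h1 (shortlex_wd_cfl_add hu N))
    | zero => simp
    | add x y _ _ h1 h2 => rw [mul_add]; exact add_mem h1 h2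
    | smul c x _ h1 => rw [mul_smul_comm]; exact Submodule.smul_mem _ _ h1
  have hxy : ∀ {x y}, x ∈ below lam f (wd M) → y ∈ below lam f (wd N) →
      x * y ∈ below lam f (wd (M + N)) := by
    intro x y hx hy
    induction hx using Submodule.span_induction with
    | mem x hx =>
      obtain ⟨u, hu, rfl⟩ := hx
      exact hyx (Or.inr hu) hy
    | zero => simp
    | add x y _ _ h1 h2 => rw [add_mul]; exact add_mem h1 h2
    | smul c x _ h1 => rw [smul_mul_assoc]; exact Submodule.smul_mem _ _ h1
  have hmain := hasMergeLead (lam := lam) hf (wd M) (wd N)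
  unfold HasMergeLead at hmain
  rw [cfl_wd, cfl_wd] at hmain
  unfold HasLead at *
  have := add_mem (add_mem (add_mem (hxy hx hy) (Submodule.smul_mem _ c (hyx (Or.inl rfl) hy)))
    (Submodule.smul_mem _ d (hxw hx))) (Submodule.smul_mem _ (c * d) hmain)
  convert this using 1
  simp only [mul_sub, sub_mul, smul_sub, smul_mul_assoc, mul_smul_comm, mul_smul, smul_comm d c]
  abel

end MixableShuffle

end LeadingWords

/-! ### Base `p` digits and binomial coefficients -/

section Digits

/-- The digits of `∑ d i * p ^ i` in base `p` are the `d i`, if these are smaller than `p`. -/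
theorem Nat.sum_mul_pow_div_pow_mod {p : ℕ} (hp : 0 < p) (d : ℕ → ℕ) (hd : ∀ i, d i < p)
    (N j : ℕ) (hj : j < N) : (∑ i ∈ Finset.range N, d i * p ^ i) / p ^ j % p = d j := by
  induction j generalizing d N with
  | zero =>
    obtain ⟨N, rfl⟩ : ∃ m, N = m + 1 := ⟨N - 1, by omega⟩
    have : ∑ i ∈ Finset.range N, d (i + 1) * p ^ (i + 1) =
        p * ∑ i ∈ Finset.range N, d (i + 1) * p ^ i := by
      rw [Finset.mul_sum]
      exact Finset.sum_congr rfl fun i _ => by ring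
    rw [Finset.sum_range_succ', this]
    simp [Nat.mod_eq_of_lt (hd 0)]
  | succ j ih =>
    obtain ⟨N, rfl⟩ : ∃ m, N = m + 1 := ⟨N - 1, by omega⟩
    have : ∑ i ∈ Finset.range N, d (i + 1) * p ^ (i + 1) =
        p * ∑ i ∈ Finset.range N, d (i + 1) * p ^ i := by
      rw [Finset.mul_sum]
      exact Finset.sum_congr rfl fun i _ => by ring
    rw [Finset.sum_range_succ', this, pow_succ', ← Nat.div_div_eq_div_mul]
    have h2 : (p * ∑ i ∈ Finset.range N, d (i + 1) * p ^ i + d 0 * p ^ 0) / p =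
        ∑ i ∈ Finset.range N, d (i + 1) * p ^ i := by
      rw [pow_zero, mul_one, Nat.mul_add_div hp, Nat.div_eq_of_lt (hd 0), add_zero]
    rw [h2]
    exact ih (fun i => d (i + 1)) (fun i => hd _) N (by omega)

theorem Nat.sum_div_pow_mod_mul_pow (p c N : ℕ) :
    ∑ i ∈ Finset.range N, c / p ^ i % p * p ^ i = c % p ^ N := by
  induction N with
  | zero => simp [Nat.mod_one]
  | succ N ih => rw [Finset.sum_range_succ, ih, Nat.mod_pow_succ, mul_comm]

/-- A case of Lucas' theorem: adding `p ^ i` to `m` without carry gives a binomial coefficient that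
is prime to `p`. -/
theorem Nat.choose_pow_add_cast_ne_zero {p : ℕ} [Fact p.Prime] (i m : ℕ)
    (h : m / p ^ i % p + 1 < p) : ((p ^ i + m).choose (p ^ i) : ZMod p) ≠ 0 := by
  have hp : p.Prime := Fact.out
  rw [Ne, ZMod.natCast_eq_zero_iff]
  induction i generalizing m with
  | zero =>
    rw [pow_zero, Nat.choose_one_right]
    intro hd
    have h1 := Nat.mod_eq_zero_of_dvd hd
    rw [add_comm, Nat.add_mod, Nat.mod_eq_of_lt hp.one_lt] at h1
    simp only [pow_zero, Nat.div_one] at h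
    rw [Nat.mod_eq_of_lt h] at h1
    omega
  | succ i ih =>
    intro hd
    have hl := Choose.choose_modEq_choose_mod_mul_choose_div_nat (n := p ^ (i + 1) + m)
      (k := p ^ (i + 1)) (p := p)
    have e1 : p ^ (i + 1) % p = 0 := by simp [pow_succ]
    have e2 : p ^ (i + 1) / p = p ^ i := by rw [pow_succ]; exact Nat.mul_div_left _ hp.pos
    have e3 : (p ^ (i + 1) + m) / p = p ^ i + m / p := by
      rw [pow_succ, mul_comm, Nat.mul_add_div hp.pos]
    rw [e1, e2, e3, Nat.choose_zero_right, one_mul] at hl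
    refine ih (m / p) ?_ ((Nat.modEq_zero_iff_dvd.1 (hl.symm.trans (Nat.modEq_zero_iff_dvd.2 hd))))
    rwa [Nat.div_div_eq_div_mul, ← pow_succ']

end Digits

/-! ### The basis of reduced monomials -/

section ReducedMonomials

/-- Exponent vectors with all entries smaller than `p`. -/
abbrev ReducedExp (p : ℕ) (Y : Type*) : Type _ := {e : Y →₀ ℕ // ∀ y, e y < p}

namespace LyndonWord

variable {S : Type*} [LinearOrder S]

/-- The multiset of Lyndon words in which `l` occurs `∑ i, e (l, i) * p ^ i` times. -/
noncomputable def ofDigits (p : ℕ) (e : LyndonWord S × ℕ →₀ ℕ) : Multiset (LyndonWord S) :=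
  e.sum fun y n => n • Multiset.replicate (p ^ y.2) y.1

theorem ofDigits_add (p : ℕ) (e e' : LyndonWord S × ℕ →₀ ℕ) :
    ofDigits p (e + e') = ofDigits p e + ofDigits p e' :=
  Finsupp.sum_add_index' (by simp) (by simp [add_smul])

theorem ofDigits_single (p : ℕ) (y : LyndonWord S × ℕ) :
    ofDigits p (Finsupp.single y 1) = Multiset.replicate (p ^ y.2) y.1 := by
  simp [ofDigits]

theorem count_ofDigits {p : ℕ} (e : LyndonWord S × ℕ →₀ ℕ) (l : LyndonWord S) {N : ℕ}
    (hN : ∀ y ∈ e.support, y.2 < N) :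
    (ofDigits p e).count l = ∑ i ∈ Finset.range N, e (l, i) * p ^ i := by
  have hsub : e.support ⊆ (insert l (e.support.image Prod.fst)) ×ˢ Finset.range N := by
    intro y hy
    simp only [Finset.mem_product, Finset.mem_insert, Finset.mem_image, Finset.mem_range]
    exact ⟨Or.inr ⟨y, hy, rfl⟩, hN y hy⟩
  rw [ofDigits, Finsupp.sum_of_support_subset _ hsub _ (by simp), Multiset.count_sum',
    Finset.sum_product, Finset.sum_eq_single l]
  · simp [Multiset.count_nsmul]
  · intro l' _ hl'
    simp [Multiset.count_nsmul, Multiset.count_replicate, hl']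
  · simp

theorem ofDigits_digit {p : ℕ} (hp : 0 < p) {e : LyndonWord S × ℕ →₀ ℕ} (he : ∀ y, e y < p)
    (y : LyndonWord S × ℕ) : (ofDigits p e).count y.1 / p ^ y.2 % p = e y := by
  rw [count_ofDigits e y.1 (N := (insert y e.support).sup Prod.snd + 1)]
  · refine Nat.sum_mul_pow_div_pow_mod hp (fun i => e (y.1, i)) (fun i => he _) _ _ ?_
    exact Nat.lt_succ_of_le (Finset.le_sup (f := Prod.snd) (Finset.mem_insert_self _ _))
  · intro z hz
    exact Nat.lt_succ_of_le (Finset.le_sup (f := Prod.snd) (Finset.mem_insert_of_mem hz))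

/-- Expansion of multiplicities in base `p`. -/
theorem ofDigits_bijective {p : ℕ} (hp : 1 < p) :
    Function.Bijective fun e : ReducedExp p (LyndonWord S × ℕ) => ofDigits p e.1 := by
  refine ⟨fun e e' h => ?_, fun M => ?_⟩
  · ext y
    rw [← ofDigits_digit (by omega) e.2, ← ofDigits_digit (by omega) e'.2]
    exact congrArg (fun M => Multiset.count y.1 M / p ^ y.2 % p) h
  · let e : LyndonWord S × ℕ →₀ ℕ :=
      Finsupp.onFinset (M.toFinset ×ˢ Finset.range (Multiset.card M + 1))
        (fun y => M.count y.1 / p ^ y.2 % p) (by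
          intro y hy
          have h1 : M.count y.1 / p ^ y.2 ≠ 0 := fun h => hy (by simp [h])
          have h2 : p ^ y.2 ≤ M.count y.1 := by
            by_contra h
            exact h1 (Nat.div_eq_of_lt (not_le.1 h))
          have h3 := Nat.lt_pow_self hp (n := y.2)
          have h4 := Multiset.count_le_card y.1 M
          have h5 : 0 < M.count y.1 := by omega
          simp only [Finset.mem_product, Multiset.mem_toFinset, Finset.mem_range]
          exact ⟨Multiset.count_pos.1 h5, by omega⟩)
    refine ⟨⟨e, fun y => Nat.mod_lt _ (by omega)⟩, ?_⟩
    ext l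
    change Multiset.count l (ofDigits p e) = _
    rw [count_ofDigits e l (N := Multiset.card M + 1)]
    · change ∑ i ∈ Finset.range (Multiset.card M + 1), M.count l / p ^ i % p * p ^ i = _
      rw [Nat.sum_div_pow_mod_mul_pow, Nat.mod_eq_of_lt]
      have := Nat.lt_pow_self hp (n := Multiset.card M + 1)
      have := Multiset.count_le_card l M
      omega
    · intro y hy
      exact Finset.mem_range.1 (Finset.mem_product.1 (Finsupp.support_onFinset_subset hy)).2

theorem cfl_wordPow (l : LyndonWord S) (n : ℕ) :
    cfl (wordPow l.1 n) = Multiset.replicate n l := by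
  refine wd_injective ?_
  rw [wd_cfl]
  induction n with
  | zero => simp [wordPow]
  | succ n ih =>
    rw [Multiset.replicate_succ, wd_cons fun m hm => (Multiset.eq_of_mem_replicate hm).le, ← ih]
    simp [wordPow, List.replicate_succ]

end LyndonWord

namespace MixableShuffle

open LyndonWord

section Basis

variable {k : Type*} [CommRing k] (lam : k) {A : Type*} [CommRing A] [Algebra k A]
  {S : Type*}

/-- The words over a basis of `A` form a basis of `Sh(A)`. -/
noncomputable def wordBasis (b : Module.Basis S k A) :
    Module.Basis (List S) k (MixableShuffle k lam A) :=
  (b.tensorAlgebra : Module.Basis (FreeMonoid S) k (TensorAlgebra k A))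

theorem wordBasis_apply (b : Module.Basis S k A) (w : List S) :
    wordBasis lam b w = word lam b w := by
  change (TensorAlgebra.equivFreeAlgebra b).symm
    (FreeAlgebra.equivMonoidAlgebraFreeMonoid.symm
      (MonoidAlgebra.single (FreeMonoid.ofList w) 1)) = _
  induction w with
  | nil =>
    change (TensorAlgebra.equivFreeAlgebra b).symm
      (FreeAlgebra.equivMonoidAlgebraFreeMonoid.symm 1) = _
    rw [map_one, map_one]; rfl
  | cons a w ih =>
    have hmul : MonoidAlgebra.single (FreeMonoid.of a * FreeMonoid.ofList w) (1 : k) =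
        MonoidAlgebra.of k _ (FreeMonoid.of a) *
          MonoidAlgebra.single (FreeMonoid.ofList w) 1 := by
      simp [MonoidAlgebra.single_mul_single]
    rw [FreeMonoid.ofList_cons, hmul, map_mul, map_mul, ih, word_cons]
    have : FreeAlgebra.equivMonoidAlgebraFreeMonoid.symm
        (MonoidAlgebra.of k _ (FreeMonoid.of a)) = FreeAlgebra.ι k a := by
      simp [FreeAlgebra.equivMonoidAlgebraFreeMonoid]
    rw [this, TensorAlgebra.equivFreeAlgebra_symm_ι]
    rfl

/-- Equal differences of words begin with the same word, provided that this word is not subtracted in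
either of them. -/
theorem eq_of_word_sub_word_eq [Nontrivial k] {lam : k} (b : Module.Basis S k A) {v v' w w' : List S}
    (h : word lam b w - word lam b w' = word lam b v - word lam b v') (hw : w' ≠ w) (hv : v' ≠ w) :
    v = w := by
  by_contra hne
  have h1 := congrArg ((wordBasis lam b).coord w) h
  simp [← wordBasis_apply, hne, hw, hv] at h1

end Basis

section Triangular

variable {k : Type*} [Field k] {lam : k} {A : Type*} [CommRing A] [Algebra k A]
  {S : Type*} [LinearOrder S] {I : Type*} {v : I → MixableShuffle k lam A} {c : I → k}
  {ψ : I → Multiset (LyndonWord S)}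

/-- Elements with distinct leading words are independent: in a relation, the coordinate at the largest
leading word involves one term only. -/
theorem linearIndependent_of_hasLead (b : Module.Basis S k A) (hc : ∀ i, c i ≠ 0)
    (hv : ∀ i, HasLead b (v i) (c i) (ψ i)) (hψ : Function.Injective ψ) :
    LinearIndependent k v := by
  classical
  have below_coord : ∀ {w w' : List S} {x}, x ∈ below lam b w →
      (w' = w ∨ List.Shortlex (· < ·) w w') → (wordBasis lam b).coord w' x = 0 := by
    intro w w' x hx hw
    induction hx using Submodule.span_induction with
    | mem x hx =>
      obtain ⟨u, hu, rfl⟩ := hx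
      have hne : u ≠ w' := by
        rintro rfl
        rcases hw with rfl | hw
        · exact irrefl_of (List.Shortlex (· < ·)) _ hu
        · exact irrefl_of (List.Shortlex (· < ·)) _ (shortlex_trans hu hw)
      rw [← wordBasis_apply]
      simp [hne.symm]
    | zero => simp
    | add x y _ _ h1 h2 => rw [map_add, h1, h2, add_zero]
    | smul a x _ h => rw [map_smul, h, smul_zero]
  rw [linearIndependent_iff]
  intro a ha
  by_contra hne
  obtain ⟨i, hi, hmax⟩ := a.support.exists_max_image
    (fun i => toLex ((wd (ψ i)).length, wd (ψ i))) (Finsupp.support_nonempty_iff.2 hne)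
  have hcoord : ∀ j ∈ a.support, (wordBasis lam b).coord (wd (ψ i)) (v j) =
      if j = i then c i else 0 := by
    intro j hj
    have hle : wd (ψ i) = wd (ψ j) ∨ List.Shortlex (· < ·) (wd (ψ j)) (wd (ψ i)) := by
      rcases (hmax j hj).eq_or_lt with h | h
      · exact Or.inl (congrArg Prod.snd (toLex_inj.1 h)).symm
      · exact Or.inr (Prod.Lex.toLex_lt_toLex'.1 h |> fun h => by
          rw [List.shortlex_def]
          rcases h.1.lt_or_eq with h' | h'
          · exact Or.inl h'
          · exact Or.inr ⟨h', h.2 h'⟩)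
    have h1 := below_coord (hv j) hle
    rw [map_sub, sub_eq_zero, map_smul, ← wordBasis_apply] at h1
    rw [h1]
    split_ifs with h
    · subst h; simp
    · have : wd (ψ i) ≠ wd (ψ j) := fun h' => h (hψ (wd_injective h')).symm
      simp [this]
  have h2 := congrArg ((wordBasis lam b).coord (wd (ψ i))) ha
  rw [Finsupp.linearCombination_apply, Finsupp.sum, map_sum, map_zero,
    Finset.sum_congr rfl (g := fun j => if j = i then a i * c i else 0)] at h2
  · rw [Finset.sum_ite_eq' a.support i, if_pos hi] at h2
    exact mul_ne_zero (Finsupp.mem_support_iff.1 hi) (hc i) h2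
  · intro j hj
    rw [map_smul, hcoord j hj]
    split_ifs with h
    · rw [h, smul_eq_mul]
    · simp

/-- Elements whose leading words exhaust all words span, by induction along the shortlex order. -/
theorem span_eq_top_of_hasLead [WellFoundedLT S] (b : Module.Basis S k A) (hc : ∀ i, c i ≠ 0)
    (hv : ∀ i, HasLead b (v i) (c i) (ψ i)) (hψ : Function.Surjective ψ) :
    Submodule.span k (Set.range v) = ⊤ := by
  have hw : ∀ w : List S, word lam b w ∈ Submodule.span k (Set.range v) := by
    intro w
    induction w using (List.Shortlex.wf (wellFounded_lt (α := S))).induction with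
    | _ w ih =>
    obtain ⟨i, hi⟩ := hψ (cfl w)
    have h1 := hv i
    rw [HasLead, hi, wd_cfl] at h1
    have h2 : v i - c i • word lam b w ∈ Submodule.span k (Set.range v) := by
      refine Submodule.span_le.2 ?_ h1
      rintro _ ⟨u, hu, rfl⟩
      exact ih u hu
    have h3 := sub_mem (Submodule.subset_span (Set.mem_range_self i)) h2
    rw [sub_sub_cancel] at h3
    exact (Submodule.smul_mem_iff _ (hc i)).1 h3
  rw [eq_top_iff, ← (wordBasis lam b).span_eq, Submodule.span_le]
  rintro _ ⟨w, rfl⟩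
  rw [wordBasis_apply]
  exact hw w

end Triangular

/-- The bijection between `T(L)` and pairs of a Lyndon word and an exponent, for an indexing `τ` of
`T(L)`. -/
theorem exists_equiv_lyndonWord_prod {p : ℕ} [Fact p.Prime] {S : Type*}
    [LinearOrder S] {Y : Type*} {τ : Y → List S} (hτ : Function.Injective τ)
    (hr : Set.range τ = setTL p S) :
    ∃ σ : Y ≃ LyndonWord S × ℕ, ∀ y, cfl (τ y) = Multiset.replicate (p ^ (σ y).2) (σ y).1 := by
  have hp : p.Prime := Fact.out
  have h1 : ∀ x : LyndonWord S × ℕ, ∃ y, τ y = wordPow x.1.1 (p ^ x.2) := fun x =>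
    hr.symm.subset ⟨x.1.1, x.1.2, x.2, rfl⟩
  choose θ hθ using h1
  have hbij : Function.Bijective θ := by
    refine ⟨fun x x' h => ?_, fun y => ?_⟩
    · have h2 : cfl (τ (θ x)) = cfl (τ (θ x')) := by rw [h]
      rw [hθ, hθ, cfl_wordPow, cfl_wordPow] at h2
      have h3 : p ^ x.2 = p ^ x'.2 := by simpa using congrArg Multiset.card h2
      have h4 : x.2 = x'.2 := Nat.pow_right_injective hp.two_le h3
      refine Prod.ext ?_ h4
      have h5 : x.1 ∈ Multiset.replicate (p ^ x'.2) x'.1 := by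
        rw [← h2]
        exact Multiset.mem_replicate.2 ⟨pow_ne_zero _ hp.ne_zero, rfl⟩
      exact Multiset.eq_of_mem_replicate h5
    · obtain ⟨l, hl, i, hi⟩ := hr.subset (Set.mem_range_self y)
      exact ⟨(⟨l, hl⟩, i), hτ (by rw [hθ, hi])⟩
  refine ⟨(Equiv.ofBijective θ hbij).symm, fun y => ?_⟩
  obtain ⟨x, rfl⟩ := hbij.2 y
  rw [Equiv.ofBijective_symm_apply_apply θ hbij, hθ, cfl_wordPow]

section Monomials

variable {p : ℕ} [Fact p.Prime] {lam : ZMod p} {A : Type*} [CommRing A] [Algebra (ZMod p) A]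
  {S : Type*} [LinearOrder S] [CommMonoid S] {f : S → A}

/-- A reduced monomial in elements with leading words `l^{⊗ p^i}` has, up to a unit, the leading word
whose Lyndon multiplicities have the given exponents as base `p` digits. -/
theorem exists_hasLead_monomial (hf : ∀ s t, f (s * t) = f s * f t)
    {g : LyndonWord S × ℕ → MixableShuffle (ZMod p) lam A}
    (hg : ∀ y, HasLead f (g y) 1 (Multiset.replicate (p ^ y.2) y.1))
    (e : LyndonWord S × ℕ →₀ ℕ) (he : ∀ y, e y < p) :
    ∃ c : ZMod p, c ≠ 0 ∧ HasLead f (e.prod fun y n => g y ^ n) c (ofDigits p e) := by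
  have hp : p.Prime := Fact.out
  induction hN : e.degree generalizing e with
  | zero =>
    obtain rfl := (Finsupp.degree_eq_zero_iff e).1 hN
    exact ⟨1, one_ne_zero, by simpa [ofDigits] using hasLead_one⟩
  | succ N ih =>
    have hne : e ≠ 0 := by rintro rfl; simp at hN
    obtain ⟨y, hy⟩ := Finsupp.support_nonempty_iff.2 hne
    have hy1 : Finsupp.single y 1 ≤ e := by
      rw [Finsupp.single_le_iff]
      exact Nat.one_le_iff_ne_zero.2 (Finsupp.mem_support_iff.1 hy)
    obtain ⟨e', rfl⟩ := exists_add_of_le hy1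
    have he' : ∀ z, e' z < p := fun z => lt_of_le_of_lt (by simp) (he z)
    obtain ⟨c, hc, hlead⟩ := ih e' he' (by simp [map_add] at hN; omega)
    refine ⟨1 * c * mult (Multiset.replicate (p ^ y.2) y.1) (ofDigits p e'), ?_, ?_⟩
    rotate_left
    · rw [Finsupp.prod_add_index' (by simp) (by simp [pow_add]), ofDigits_add, ofDigits_single,
        Finsupp.prod_single_index (by simp), pow_one]
      exact (hg y).mul hf hlead
    -- the digit of the multiplicity at place `i` rises to at most `p - 1`, so there is no carry
    · refine mul_ne_zero (mul_ne_zero one_ne_zero hc) ?_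
      rw [mult_eq_prod (s := {y.1}) (by
        intro n hn _
        simpa using Multiset.eq_of_mem_replicate hn), Finset.prod_singleton,
        Multiset.count_replicate_self]
      refine Nat.choose_pow_add_cast_ne_zero _ _ ?_
      rw [ofDigits_digit hp.pos he']
      have := he y
      simpa [add_comm] using this

/-- If each `g y` has the leading word `τ y`, where `τ` enumerates `T(L)`, then the reduced monomials
in the `g y` form a basis of `Sh(A)`. -/
theorem reducedMonomials_basis [WellFoundedLT S] (b : Module.Basis S (ZMod p) A)
    (hb : ∀ s t, b (s * t) = b s * b t) {Y : Type*} {τ : Y → List S}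
    (hτ : Function.Injective τ) (hr : Set.range τ = setTL p S)
    {g : Y → MixableShuffle (ZMod p) lam A} (hg : ∀ y, HasLead b (g y) 1 (cfl (τ y))) :
    LinearIndependent (ZMod p) (fun e : ReducedExp p Y => e.1.prod fun y n => g y ^ n) ∧
      Submodule.span (ZMod p) (Set.range fun e : ReducedExp p Y => e.1.prod fun y n => g y ^ n) =
        ⊤ := by
  have hp : p.Prime := Fact.out
  obtain ⟨σ, hσ⟩ := exists_equiv_lyndonWord_prod hτ hr
  let F : ReducedExp p Y ≃ ReducedExp p (LyndonWord S × ℕ) :=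
    (Finsupp.equivCongrLeft σ).subtypeEquiv fun e => by
      exact (σ.symm.forall_congr_right (q := fun y => e y < p)).symm
  have hlead : ∀ e : ReducedExp p Y, ∃ c : ZMod p, c ≠ 0 ∧
      HasLead b (e.1.prod fun y n => g y ^ n) c (ofDigits p (F e).1) := by
    intro e
    have h1 := exists_hasLead_monomial (g := g ∘ σ.symm) hb
      (fun y => by simpa [hσ] using hg (σ.symm y)) (F e).1 (F e).2
    have h2 : (F e).1.prod (fun y n => (g ∘ σ.symm) y ^ n) = e.1.prod fun y n => g y ^ n := by
      change (Finsupp.equivMapDomain σ e.1).prod _ = _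
      rw [Finsupp.prod_equivMapDomain]
      simp
    rwa [h2] at h1
  choose c hc hv using hlead
  have hbij := (ofDigits_bijective (S := S) hp.one_lt).comp F.bijective
  exact ⟨linearIndependent_of_hasLead b hc hv hbij.1, span_eq_top_of_hasLead b hc hv hbij.2⟩

end Monomials

end MixableShuffle

end ReducedMonomials

/-! ### The `p`-th power in the mixable shuffle algebra -/

section Frobenius

variable {p : ℕ} [Fact p.Prime]

theorem ZMod.add_pow_prime {R : Type*} [CommRing R] [Algebra (ZMod p) R] (x y : R) :
    (x + y) ^ p = x ^ p + y ^ p := by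
  have h0 : (p : R) = 0 := by
    rw [← map_natCast (algebraMap (ZMod p) R), ZMod.natCast_self, map_zero]
  rw [add_pow_prime_eq Fact.out, h0]
  simp

theorem ZMod.sub_pow_prime {R : Type*} [CommRing R] [Algebra (ZMod p) R] (x y : R) :
    (x - y) ^ p = x ^ p - y ^ p := by
  rw [eq_sub_iff_add_eq, ← ZMod.add_pow_prime, sub_add_cancel]

namespace FreeCommRotaBaxter

variable {k : Type*} [CommRing k] (lam : k) {A : Type*} [CommRing A] [Algebra k A]

theorem P_eq (y : FreeCommRotaBaxter k lam A) : P lam y = 1 ⊗ₜ cons lam y := rfl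

/-- Powers for the double product `y ⋆ z = y P(z) + P(y) z + lam y z` that the Rota-Baxter operator
turns into the product. -/
theorem exists_cons_pow (y : FreeCommRotaBaxter k lam A) (n : ℕ) :
    ∃ z, cons lam y ^ (n + 1) = cons lam z ∧
      lam • z = (P lam y + lam • y) ^ (n + 1) - P lam y ^ (n + 1) := by
  induction n with
  | zero => exact ⟨y, by simp, by simp⟩
  | succ n ih =>
    obtain ⟨z, h1, h2⟩ := ih
    have hz : P lam z = P lam y ^ (n + 1) := by
      rw [P_eq, P_eq, ← h1, Algebra.TensorProduct.tmul_pow, one_pow]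
    refine ⟨z * P lam y + P lam z * y + lam • (z * y), ?_, ?_⟩
    · rw [pow_succ, h1, cons_mul_cons, map_add, map_add, map_smul]
    · have h3 : lam • (z * P lam y + P lam z * y + lam • (z * y)) =
          lam • z * (P lam y + lam • y) + P lam z * (lam • y) := by
        simp only [smul_add, mul_add, smul_mul_assoc, mul_smul_comm]
        abel
      rw [h3, h2, hz, pow_succ _ (n + 1), pow_succ (P lam y) (n + 1)]
      ring

/-- In weight zero the analogous power carries the factor `n + 1`, which vanishes in characteristic
`n + 1`. -/
theorem exists_cons_pow_zero (y : FreeCommRotaBaxter k 0 A) (n : ℕ) :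
    cons 0 y ^ (n + 1) = cons 0 (((n + 1 : ℕ) : k) • (P 0 y ^ n * y)) := by
  induction n with
  | zero => simp
  | succ n ih =>
    have hz : P 0 (((n + 1 : ℕ) : k) • (P 0 y ^ n * y)) = P 0 y ^ (n + 1) := by
      rw [P_eq, ← ih, P_eq, Algebra.TensorProduct.tmul_pow, one_pow]
    rw [pow_succ, ih, cons_mul_cons, hz, zero_smul, add_zero, ← map_add]
    congr 1
    rw [Nat.cast_succ (n + 1), add_smul, one_smul, smul_mul_assoc]
    congr 2
    ring

end FreeCommRotaBaxter

namespace MixableShuffle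

variable {A : Type*} [CommRing A] [Algebra (ZMod p) A]

theorem prepend_eq_cons {k : Type*} [CommRing k] (lam : k) {A : Type*} [CommRing A] [Algebra k A]
    (a : A) (x : MixableShuffle k lam A) :
    prepend lam a x = FreeCommRotaBaxter.cons lam (a ⊗ₜ x) := rfl

/-- In non-zero weight prepending a factor commutes with the `p`-th power. For `y = a ⊗ x` the double
product power `z` satisfies `lam z = (P y + lam y)^p - (P y)^p = lam^p y^p = lam y^p`. -/
theorem prepend_pow {lam : ZMod p} (hlam : lam ≠ 0) (a : A) (x : MixableShuffle (ZMod p) lam A) :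
    prepend lam a x ^ p = prepend lam (a ^ p) (x ^ p) := by
  have hp : p.Prime := Fact.out
  obtain ⟨z, h1, h2⟩ := FreeCommRotaBaxter.exists_cons_pow lam (a ⊗ₜ[ZMod p] x) (p - 1)
  rw [Nat.sub_add_cancel hp.one_le] at h1 h2
  rw [ZMod.add_pow_prime, add_sub_cancel_left, smul_pow, ZMod.pow_card] at h2
  have hz : z = (a ⊗ₜ[ZMod p] x) ^ p := by
    have := congrArg (lam⁻¹ • ·) h2
    simpa [smul_smul, hlam] using this
  rw [prepend_eq_cons, h1, hz, Algebra.TensorProduct.tmul_pow, prepend_eq_cons]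

theorem prepend_pow_zero (a : A) (x : MixableShuffle (ZMod p) 0 A) : prepend 0 a x ^ p = 0 := by
  have hp : p.Prime := Fact.out
  have h := FreeCommRotaBaxter.exists_cons_pow_zero (a ⊗ₜ[ZMod p] x) (p - 1)
  rw [Nat.sub_add_cancel hp.one_le, ZMod.natCast_self, zero_smul, map_zero] at h
  exact h

theorem word_pow {lam : ZMod p} (hlam : lam ≠ 0) {S : Type*} [CommMonoid S] {f : S → A}
    (hf : ∀ s, f (s ^ p) = f s ^ p) (w : List S) :
    word lam f w ^ p = word lam f (letterPow p w) := by
  induction w with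
  | nil => simp [letterPow]
  | cons a w ih =>
    rw [word_cons, prepend_pow hlam, ih, ← hf]
    simp [letterPow]

theorem word_pow_zero {S : Type*} (f : S → A) {w : List S} (hw : w ≠ []) :
    word (0 : ZMod p) f w ^ p = 0 := by
  cases w with
  | nil => exact absurd rfl hw
  | cons a w => rw [word_cons, prepend_pow_zero]

end MixableShuffle

end Frobenius

/-! ### Algebras given by generators and relations -/

namespace PresentedAlg

section Lift

variable {k : Type*} [CommRing k] {Y : Type*} {R : Set (MvPolynomial Y k)}
  {B : Type*} [CommRing B] [Algebra k B]

/-- The quotient map `k[Y] → k[Y] / ⟨R⟩`. -/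
noncomputable def mk (R : Set (MvPolynomial Y k)) : MvPolynomial Y k →ₐ[k] PresentedAlg R :=
  Ideal.Quotient.mkₐ k (Ideal.span R)

theorem mk_surjective : Function.Surjective (mk R) := Ideal.Quotient.mkₐ_surjective k _

@[simp] theorem mk_X (y : Y) : mk R (MvPolynomial.X y) = gen R y := rfl

theorem mk_eq_zero {x : MvPolynomial Y k} (hx : x ∈ R) : mk R x = 0 :=
  Ideal.Quotient.eq_zero_iff_mem.2 (Ideal.subset_span hx)

/-- The homomorphism given by values on the generators that satisfy the relations. -/
noncomputable def lift (g : Y → B) (hg : ∀ r ∈ R, MvPolynomial.aeval g r = 0) :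
    PresentedAlg R →ₐ[k] B :=
  Ideal.Quotient.liftₐ (Ideal.span R) (MvPolynomial.aeval g) fun a ha => by
    have : Ideal.span R ≤ RingHom.ker (MvPolynomial.aeval g : MvPolynomial Y k →ₐ[k] B) :=
      Ideal.span_le.2 hg
    exact this ha

theorem lift_mk (g : Y → B) (hg : ∀ r ∈ R, MvPolynomial.aeval g r = 0) (x : MvPolynomial Y k) :
    lift g hg (mk R x) = MvPolynomial.aeval g x := rfl

@[simp] theorem lift_gen (g : Y → B) (hg : ∀ r ∈ R, MvPolynomial.aeval g r = 0) (y : Y) :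
    lift g hg (gen R y) = g y := by
  rw [← mk_X, lift_mk, MvPolynomial.aeval_X]

theorem algHom_ext {φ ψ : PresentedAlg R →ₐ[k] B} (h : ∀ y, φ (gen R y) = ψ (gen R y)) : φ = ψ := by
  have h1 : φ.comp (mk R) = ψ.comp (mk R) := MvPolynomial.algHom_ext fun y => h y
  ext x
  obtain ⟨x, rfl⟩ := mk_surjective x
  exact congrArg (fun f => f x) h1

end Lift

/-- A commutative algebra in which the reduced monomials in elements `g y` form a basis is presented
by relations that express each `(g y)^p` through a polynomial of degree less than `p`. -/
theorem exists_algEquiv {k : Type*} [CommRing k] {Y : Type*} {p : ℕ}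
    {R : Y → MvPolynomial Y k}
    (hdeg : ∀ y, (MvPolynomial.X y ^ p - R y).totalDegree < p)
    {B : Type*} [CommRing B] [Algebra k B] {g : Y → B}
    (hR : ∀ y, MvPolynomial.aeval g (R y) = 0)
    (hli : LinearIndependent k fun e : ReducedExp p Y => e.1.prod fun y n => g y ^ n)
    (hspan : Submodule.span k (Set.range fun e : ReducedExp p Y => e.1.prod fun y n => g y ^ n) = ⊤) :
    ∃ e : B ≃ₐ[k] PresentedAlg (Set.range R), ∀ y, e (g y) = gen _ y := by
  have hR' : ∀ r ∈ Set.range R, MvPolynomial.aeval g r = 0 := by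
    rintro _ ⟨y, rfl⟩
    exact hR y
  set Φ := lift g hR' with hΦ
  -- the reduced monomials span the presented algebra, by induction on the degree
  set m : ReducedExp p Y → PresentedAlg (Set.range R) :=
    fun e => mk _ (MvPolynomial.monomial e.1 1) with hm
  have hmon : ∀ e : Y →₀ ℕ, mk (Set.range R) (MvPolynomial.monomial e 1) ∈
      Submodule.span k (Set.range m) := by
    intro e
    induction hN : e.degree using Nat.strong_induction_on generalizing e with
    | _ N ih =>
    subst hN
    by_cases he : ∀ y, e y < p
    · exact Submodule.subset_span ⟨⟨e, he⟩, rfl⟩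
    push Not at he
    obtain ⟨y, hy⟩ := he
    obtain ⟨e', rfl⟩ := exists_add_of_le (Finsupp.single_le_iff.2 hy)
    have h1 : mk (Set.range R) (MvPolynomial.monomial (Finsupp.single y p + e') 1) =
        mk (Set.range R) ((MvPolynomial.X y ^ p - R y) * MvPolynomial.monomial e' 1) := by
      rw [sub_mul, map_sub, map_mul _ (R y), mk_eq_zero (Set.mem_range_self y), zero_mul, sub_zero,
        MvPolynomial.X_pow_eq_monomial, MvPolynomial.monomial_mul, one_mul]
    rw [h1]
    generalize hq : (MvPolynomial.X y ^ p - R y) = q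
    have hqd : q.totalDegree < p := hq ▸ hdeg y
    rw [q.as_sum, Finset.sum_mul, map_sum]
    refine Submodule.sum_mem _ fun d hd => ?_
    rw [MvPolynomial.monomial_mul, mul_one, ← mul_one (q.coeff d), ← smul_eq_mul,
      ← MvPolynomial.smul_monomial, map_smul]
    refine Submodule.smul_mem _ _ (ih _ ?_ _ rfl)
    rw [map_add, map_add, Finsupp.degree_single]
    have h2 : d.degree ≤ q.totalDegree := MvPolynomial.le_totalDegree hd
    omega
  have hmspan : Submodule.span k (Set.range m) = ⊤ := by
    rw [eq_top_iff]
    rintro x -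
    obtain ⟨x, rfl⟩ := mk_surjective x
    rw [x.as_sum, map_sum]
    refine Submodule.sum_mem _ fun d _ => ?_
    rw [← mul_one (x.coeff d), ← smul_eq_mul, ← MvPolynomial.smul_monomial, map_smul]
    exact Submodule.smul_mem _ _ (hmon d)
  have hΦm : (Φ.toLinearMap ∘ m) = fun e : ReducedExp p Y => e.1.prod fun y n => g y ^ n := by
    funext e
    change Φ (mk _ _) = _
    rw [hΦ, lift_mk, MvPolynomial.aeval_monomial, map_one, one_mul]
  have hsurj : Function.Surjective Φ := by
    have : LinearMap.range Φ.toLinearMap = ⊤ := by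
      rw [eq_top_iff, ← hspan, ← hΦm, Submodule.span_le]
      rintro _ ⟨e, rfl⟩
      exact ⟨m e, rfl⟩
    exact LinearMap.range_eq_top.1 this
  have hinj : Function.Injective Φ := by
    rw [injective_iff_map_eq_zero]
    intro x hx
    have hxs : x ∈ Submodule.span k (Set.range m) := hmspan ▸ Submodule.mem_top
    obtain ⟨c, rfl⟩ := (Finsupp.mem_span_range_iff_exists_finsupp).1 hxs
    have h0 : Finsupp.linearCombination k (Φ.toLinearMap ∘ m) c = 0 := by
      rw [Finsupp.linearCombination_apply, ← hx, map_finsuppSum]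
      simp
    rw [hΦm] at h0
    rw [linearIndependent_iff.1 hli c h0]
    simp
  have hbij : Function.Bijective Φ := ⟨hinj, hsurj⟩
  exact ⟨(AlgEquiv.ofBijective Φ hbij).symm, fun y =>
    (AlgEquiv.ofBijective Φ hbij).symm_apply_eq.2 (lift_gen g hR' y).symm⟩

end PresentedAlg

namespace PresentedAlg

section Sum

variable {k : Type*} [CommRing k] {Y₁ Y₂ : Type*} {R₁ : Y₁ → MvPolynomial Y₁ k}
  {R₂ : Y₂ → MvPolynomial Y₂ k} {R : Y₁ ⊕ Y₂ → MvPolynomial (Y₁ ⊕ Y₂) k}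

/-- Relations that do not mix two sets of variables present the tensor product. -/
theorem exists_tensor_algEquiv (h₁ : ∀ y, R (Sum.inl y) = MvPolynomial.rename Sum.inl (R₁ y))
    (h₂ : ∀ y, R (Sum.inr y) = MvPolynomial.rename Sum.inr (R₂ y)) :
    ∃ e : PresentedAlg (Set.range R) ≃ₐ[k] PresentedAlg (Set.range R₁) ⊗[k] PresentedAlg (Set.range R₂),
      (∀ y, e (gen _ (Sum.inl y)) = gen _ y ⊗ₜ 1) ∧ ∀ y, e (gen _ (Sum.inr y)) = 1 ⊗ₜ gen _ y := by
  have a₁ : ∀ r ∈ Set.range R₁,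
      MvPolynomial.aeval (fun y => gen (Set.range R) (Sum.inl y)) r = 0 := by
    rintro _ ⟨y, rfl⟩
    have := mk_eq_zero (Set.mem_range_self (f := R) (Sum.inl y))
    rw [h₁] at this
    have hcomp : MvPolynomial.aeval (fun y => gen (Set.range R) (Sum.inl y)) =
        (mk (Set.range R)).comp (MvPolynomial.rename Sum.inl) := by
      ext; simp
    rw [← this, hcomp, AlgHom.comp_apply]
  have a₂ : ∀ r ∈ Set.range R₂,
      MvPolynomial.aeval (fun y => gen (Set.range R) (Sum.inr y)) r = 0 := by
    rintro _ ⟨y, rfl⟩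
    have := mk_eq_zero (Set.mem_range_self (f := R) (Sum.inr y))
    rw [h₂] at this
    have hcomp : MvPolynomial.aeval (fun y => gen (Set.range R) (Sum.inr y)) =
        (mk (Set.range R)).comp (MvPolynomial.rename Sum.inr) := by
      ext; simp
    rw [← this, hcomp, AlgHom.comp_apply]
  let g : Y₁ ⊕ Y₂ → PresentedAlg (Set.range R₁) ⊗[k] PresentedAlg (Set.range R₂) :=
    Sum.elim (fun y => gen _ y ⊗ₜ 1) (fun y => 1 ⊗ₜ gen _ y)
  have a : ∀ r ∈ Set.range R, MvPolynomial.aeval g r = 0 := by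
    rintro _ ⟨y | y, rfl⟩
    · have h0 : MvPolynomial.aeval g (R (Sum.inl y)) =
          Algebra.TensorProduct.includeLeft (R := k) (S := k) (mk (Set.range R₁) (R₁ y)) := by
        rw [h₁]
        have hcomp : (MvPolynomial.aeval g).comp (MvPolynomial.rename Sum.inl) =
            (Algebra.TensorProduct.includeLeft (R := k) (S := k)).comp (mk (Set.range R₁)) := by
          ext; simp [g]
        exact DFunLike.congr_fun hcomp _
      rw [h0, mk_eq_zero (Set.mem_range_self y), map_zero]
    · have h0 : MvPolynomial.aeval g (R (Sum.inr y)) =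
          Algebra.TensorProduct.includeRight (R := k) (mk (Set.range R₂) (R₂ y)) := by
        rw [h₂]
        have hcomp : (MvPolynomial.aeval g).comp (MvPolynomial.rename Sum.inr) =
            (Algebra.TensorProduct.includeRight (R := k)).comp (mk (Set.range R₂)) := by
          ext; simp [g]
        exact DFunLike.congr_fun hcomp _
      rw [h0, mk_eq_zero (Set.mem_range_self y), map_zero]
  refine ⟨AlgEquiv.ofAlgHom (lift g a)
    (Algebra.TensorProduct.lift (lift _ a₁) (lift _ a₂) fun _ _ => Commute.all _ _) ?_ ?_, ?_, ?_⟩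
  · refine Algebra.TensorProduct.ext (algHom_ext fun y => ?_) (algHom_ext fun y => ?_) <;> simp [g]
  · refine algHom_ext fun y => ?_
    rcases y with y | y <;> simp [g]
  · intro y; simp [g]
  · intro y; simp [g]

end Sum

/-- The relations `X (t, j) ^ p = X (t, j + 1)` eliminate all variables but the `X (t, 0)`. -/
theorem exists_mvPolynomial_algEquiv (k : Type*) [CommRing k] (T : Type*) (p : ℕ) :
    ∃ e : PresentedAlg (Set.range fun y : T × ℕ =>
        (MvPolynomial.X y ^ p - MvPolynomial.X (y.1, y.2 + 1) : MvPolynomial (T × ℕ) k)) ≃ₐ[k]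
        MvPolynomial T k,
      ∀ t, e (gen _ (t, 0)) = MvPolynomial.X t := by
  set R : T × ℕ → MvPolynomial (T × ℕ) k :=
    fun y => MvPolynomial.X y ^ p - MvPolynomial.X (y.1, y.2 + 1) with hR
  have hgen : ∀ t j, gen (Set.range R) (t, j + 1) = gen (Set.range R) (t, j) ^ p := by
    intro t j
    have := mk_eq_zero (Set.mem_range_self (f := R) (t, j))
    rw [hR] at this
    simp only [map_sub, map_pow, mk_X, sub_eq_zero] at this
    exact this.symm
  let g : T × ℕ → MvPolynomial T k := fun y => MvPolynomial.X y.1 ^ p ^ y.2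
  have hg : ∀ r ∈ Set.range R, MvPolynomial.aeval g r = 0 := by
    rintro _ ⟨y, rfl⟩
    simp [hR, g, ← pow_mul, pow_succ]
  refine ⟨AlgEquiv.ofAlgHom (lift g hg) (MvPolynomial.aeval fun t => gen _ (t, 0)) ?_ ?_, ?_⟩
  · ext t; simp [g]
  · refine algHom_ext fun y => ?_
    obtain ⟨t, j⟩ := y
    simp only [AlgHom.comp_apply, lift_gen, g, map_pow, MvPolynomial.aeval_X, AlgHom.id_apply]
    induction j with
    | zero => simp
    | succ j ih => rw [pow_succ, pow_mul, ih, hgen]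
  · intro t; simp [g]

section MonoidAlgebra

/-- If the cyclic monoid `G` is presented by one relation, then `k[G^X]` is presented by that relation
for each `x ∈ X`. -/
theorem exists_monoidAlgebra_algEquiv {k : Type*} [CommRing k] {X : Type*} [Finite X]
    [DecidableEq X] {G : Type*} [CommMonoid G] {ξ : G} (hξ : Submonoid.closure {ξ} = ⊤)
    {R : X → MvPolynomial X k}
    (hR : ∀ x, MvPolynomial.aeval (fun x => MonoidAlgebra.of k (X → G) (Pi.mulSingle x ξ)) (R x) = 0)
    (h : X → G →* PresentedAlg (Set.range R)) (hh : ∀ x, h x ξ = gen _ x) :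
    ∃ f : MonoidAlgebra k (X → G) ≃ₐ[k] PresentedAlg (Set.range R),
      ∀ x, f (MonoidAlgebra.of k (X → G) (Pi.mulSingle x ξ)) = gen _ x := by
  have := Fintype.ofFinite X
  have hR' : ∀ r ∈ Set.range R,
      MvPolynomial.aeval (fun x => MonoidAlgebra.of k (X → G) (Pi.mulSingle x ξ)) r = 0 := by
    rintro _ ⟨x, rfl⟩
    exact hR x
  let H : (X → G) →* PresentedAlg (Set.range R) :=
    { toFun := fun s => ∏ x, h x (s x)
      map_one' := by simp
      map_mul' := fun s t => by simp [Finset.prod_mul_distrib] }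
  have hH : ∀ x g, H (Pi.mulSingle x g) = h x g := by
    intro x g
    change ∏ y, h y ((Pi.mulSingle x g : X → G) y) = _
    rw [Finset.prod_eq_single x]
    · simp
    · intro y _ hy
      simp [Pi.mulSingle_eq_of_ne hy]
    · simp
  have hback : ∀ x g, lift _ hR' (h x g) = MonoidAlgebra.of k (X → G) (Pi.mulSingle x g) := by
    intro x
    have : ((lift _ hR' : _ →ₐ[k] _) : _ →* _).comp (h x) =
        (MonoidAlgebra.of k (X → G)).comp (MonoidHom.mulSingle (fun _ => G) x) := by
      refine MonoidHom.eq_of_eqOn_denseM hξ ?_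
      intro y hy
      rw [Set.mem_singleton_iff.1 hy]
      change lift _ hR' (h x ξ) = MonoidAlgebra.of k (X → G) (Pi.mulSingle x ξ)
      rw [hh, lift_gen]
    exact fun g => DFunLike.congr_fun this g
  refine ⟨AlgEquiv.ofAlgHom (MonoidAlgebra.lift k _ _ H) (lift _ hR') ?_ ?_, fun x => ?_⟩
  · refine algHom_ext fun x => ?_
    rw [AlgHom.comp_apply, lift_gen, MonoidAlgebra.lift_of, hH, hh, AlgHom.id_apply]
  · refine MonoidAlgebra.algHom_ext (fun s => ?_) (by ext)
    change lift _ hR' (MonoidAlgebra.lift k _ _ H (MonoidAlgebra.of k (X → G) s)) =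
      MonoidAlgebra.of k (X → G) s
    rw [MonoidAlgebra.lift_of]
    change lift _ hR' (∏ x, h x (s x)) = _
    rw [map_prod, Finset.prod_congr rfl fun x _ => hback x (s x), ← map_prod,
      Finset.univ_prod_mulSingle]
  · change MonoidAlgebra.lift k _ _ H _ = _
    rw [MonoidAlgebra.lift_of, hH, hh]

end MonoidAlgebra

end PresentedAlg

/-! ### The algebras `F_p[X] / ⟨x^p - x⟩` and `F_p[X] / ⟨x^p - 1⟩` as monoid algebras -/

section GeneratingAlgebras

variable (p : ℕ) [Fact p.Prime] (X : Type*) [Finite X] [DecidableEq X]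

/-- If `x ^ (n + 1) = x`, then the powers of `x` with positive exponent depend only on the exponent
modulo `n`. -/
theorem pow_mod_add_eq {Q : Type*} [Monoid Q] {x : Q} {n : ℕ} (hx : x ^ (n + 1) = x)
    (hn : 0 < n) (a : ℕ) : x ^ (a % n + n) = x ^ (a + n) := by
  have h2 : x ^ (n + n) = x ^ n := by
    obtain ⟨m, rfl⟩ : ∃ m, n = m + 1 := ⟨n - 1, by omega⟩
    rw [show m + 1 + (m + 1) = (m + 1 + 1) + m by ring, pow_add, hx, ← pow_succ']
  have h3 : ∀ c, x ^ (n * c + n) = x ^ n := by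
    intro c
    induction c with
    | zero => simp
    | succ c ih => rw [mul_add, mul_one, pow_add, ih, ← pow_add, h2]
  conv_rhs => rw [← Nat.mod_add_div a n, add_assoc, pow_add, h3, ← pow_add]

theorem Multiplicative.ofAdd_one_pow {n : ℕ} (m : ℕ) :
    (Multiplicative.ofAdd (1 : ZMod n) : Multiplicative (ZMod n)) ^ m =
      Multiplicative.ofAdd (m : ZMod n) := by
  rw [← ofAdd_nsmul, nsmul_one]

theorem Multiplicative.closure_ofAdd_one (n : ℕ) [NeZero n] :
    Submonoid.closure ({Multiplicative.ofAdd (1 : ZMod n)} : Set (Multiplicative (ZMod n))) = ⊤ := by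
  rw [eq_top_iff]
  rintro z -
  refine Submonoid.mem_closure_singleton.2 ⟨ZMod.val (Multiplicative.toAdd z), ?_⟩
  rw [Multiplicative.ofAdd_one_pow, ZMod.natCast_zmod_val]
  rfl

theorem WithOne.coe_pow_succ {G : Type*} [Monoid G] (g : G) (m : ℕ) :
    (g : WithOne G) ^ (m + 1) = ((g ^ (m + 1) : G) : WithOne G) := by
  induction m with
  | zero => rw [pow_one, pow_one]
  | succ m ih => rw [pow_succ, ih, pow_succ _ (m + 1), WithOne.coe_mul]

theorem WithOne.closure_coe {G : Type*} [Monoid G] {g : G} (hg : Submonoid.closure {g} = ⊤)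
    {n : ℕ} (hn : 0 < n) (hgn : g ^ n = 1) : Submonoid.closure {(g : WithOne G)} = ⊤ := by
  rw [eq_top_iff]
  rintro z -
  rcases z with _ | z
  · exact one_mem _
  · have hz : z ∈ Submonoid.closure {g} := hg ▸ Submonoid.mem_top z
    obtain ⟨m, rfl⟩ := Submonoid.mem_closure_singleton.1 hz
    have h1 : (g : WithOne G) ^ (m + (n - 1) + 1) = ((g ^ m : G) : WithOne G) := by
      rw [WithOne.coe_pow_succ, show m + (n - 1) + 1 = m + n by omega, pow_add, hgn, mul_one]
    exact Submonoid.mem_closure_singleton.2 ⟨_, h1⟩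

theorem Multiplicative.exists_hom {n : ℕ} [NeZero n] {Q : Type*} [Monoid Q] {x : Q}
    (hx : x ^ n = 1) :
    ∃ h : Multiplicative (ZMod n) →* Q, h (Multiplicative.ofAdd (1 : ZMod n)) = x := by
  have hmul : ∀ z w : ZMod n, x ^ (z + w).val = x ^ z.val * x ^ w.val := by
    intro z w
    rw [ZMod.val_add, ← pow_eq_pow_mod _ hx, pow_add]
  let F : Multiplicative (ZMod n) →* Q :=
    { toFun := fun z => x ^ ZMod.val (Multiplicative.toAdd z)
      map_one' := by rw [toAdd_one, ZMod.val_zero, pow_zero]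
      map_mul' := fun z w => hmul _ _ }
  refine ⟨F, ?_⟩
  change x ^ (1 : ZMod n).val = x
  rw [← Nat.cast_one, ZMod.val_natCast, ← pow_eq_pow_mod _ hx, pow_one]

theorem WithOne.exists_hom {n : ℕ} [NeZero n] {Q : Type*} [Monoid Q] {x : Q}
    (hx : x ^ (n + 1) = x) : ∃ h : WithOne (Multiplicative (ZMod n)) →* Q,
      h ((Multiplicative.ofAdd (1 : ZMod n) : Multiplicative (ZMod n))) = x := by
  have hn : 0 < n := NeZero.pos n
  refine ⟨WithOne.lift
    { toFun := fun z => x ^ (ZMod.val (Multiplicative.toAdd z) + n)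
      map_mul' := fun z w => ?_ }, ?_⟩
  · rw [toAdd_mul, ZMod.val_add, pow_mod_add_eq hx hn, ← pow_add,
      show ZMod.val (Multiplicative.toAdd z) + n + (ZMod.val (Multiplicative.toAdd w) + n) =
        (ZMod.val (Multiplicative.toAdd z) + ZMod.val (Multiplicative.toAdd w) + n) + n by ring,
      ← pow_mod_add_eq hx hn (_ + _ + n), Nat.add_mod_right, pow_mod_add_eq hx hn]
  · rw [WithOne.lift_coe]
    change x ^ ((1 : ZMod n).val + n) = x
    rw [← Nat.cast_one, ZMod.val_natCast, pow_mod_add_eq hx hn, add_comm, hx]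

/-- With an identity adjoined, `μ_{p-1}` becomes the cyclic monoid with the single relation `ξ^p = ξ`. -/
theorem IdemMonoid.exists_algEquiv :
    ∃ f : MonoidAlgebra (ZMod p) (IdemMonoid p X) ≃ₐ[ZMod p] IdemAlg p X,
      ∀ x : X, f (MonoidAlgebra.of (ZMod p) (IdemMonoid p X) (IdemMonoid.gen p x)) =
        PresentedAlg.gen _ x := by
  have hp1 : 0 < p - 1 := by have := (Fact.out : p.Prime).two_le; omega
  have hpp : p - 1 + 1 = p := by omega
  have : NeZero (p - 1) := ⟨hp1.ne'⟩
  let g : Multiplicative (ZMod (p - 1)) := Multiplicative.ofAdd (1 : ZMod (p - 1))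
  have hgn : g ^ (p - 1) = 1 := by
    change (Multiplicative.ofAdd (1 : ZMod (p - 1)) : Multiplicative (ZMod (p - 1))) ^ (p - 1) = 1
    rw [Multiplicative.ofAdd_one_pow, ZMod.natCast_self, ofAdd_zero]
  have hξp : (g : WithOne (Multiplicative (ZMod (p - 1)))) ^ p = g := by
    have h := WithOne.coe_pow_succ g (p - 1)
    rwa [pow_succ g, hgn, one_mul, hpp] at h
  have hgen : ∀ x : X, (PresentedAlg.gen _ x : IdemAlg p X) ^ (p - 1 + 1) =
      PresentedAlg.gen _ x := by
    intro x
    have := PresentedAlg.mk_eq_zero (Set.mem_range_self (f := fun x : X =>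
      (MvPolynomial.X x ^ p - MvPolynomial.X x : MvPolynomial X (ZMod p))) x)
    rw [hpp]
    rwa [map_sub, map_pow, PresentedAlg.mk_X, sub_eq_zero] at this
  choose h hh using fun x => WithOne.exists_hom (hgen x)
  obtain ⟨f, hf⟩ := PresentedAlg.exists_monoidAlgebra_algEquiv (k := ZMod p)
    (WithOne.closure_coe (Multiplicative.closure_ofAdd_one (p - 1)) hp1 hgn) (fun x => by
      rw [map_sub, map_pow, MvPolynomial.aeval_X, ← map_pow, ← Pi.mulSingle_pow, hξp, sub_self])
    h hh
  have hx : ∀ x : X, (Pi.mulSingle x (g : WithOne (Multiplicative (ZMod (p - 1)))) :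
      X → WithOne (Multiplicative (ZMod (p - 1)))) = IdemMonoid.gen p x := fun x => by
    funext y
    rw [Pi.mulSingle_apply]
    rfl
  exact ⟨f, fun x => (congrArg (fun s => f (MonoidAlgebra.of (ZMod p) _ s)) (hx x)).symm.trans (hf x)⟩

theorem ElemGroup.exists_algEquiv :
    ∃ f : MonoidAlgebra (ZMod p) (ElemGroup p X) ≃ₐ[ZMod p] ElemAlg p X,
      ∀ x : X, f (MonoidAlgebra.of (ZMod p) (ElemGroup p X) (ElemGroup.gen p x)) =
        PresentedAlg.gen _ x := by
  have hξp : (Multiplicative.ofAdd (1 : ZMod p) : Multiplicative (ZMod p)) ^ p = 1 := by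
    rw [Multiplicative.ofAdd_one_pow, ZMod.natCast_self, ofAdd_zero]
  have hgen : ∀ x : X, (PresentedAlg.gen _ x : ElemAlg p X) ^ p = 1 := by
    intro x
    have := PresentedAlg.mk_eq_zero (Set.mem_range_self (f := fun x : X =>
      (MvPolynomial.X x ^ p - 1 : MvPolynomial X (ZMod p))) x)
    rwa [map_sub, map_pow, PresentedAlg.mk_X, map_one, sub_eq_zero] at this
  choose h hh using fun x => Multiplicative.exists_hom (hgen x)
  obtain ⟨f, hf⟩ := PresentedAlg.exists_monoidAlgebra_algEquiv (k := ZMod p)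
    (Multiplicative.closure_ofAdd_one p) (fun x => by
      rw [map_sub, map_pow, MvPolynomial.aeval_X, ← map_pow, ← Pi.mulSingle_pow, hξp,
        Pi.mulSingle_one, map_one, map_one, sub_self])
    h hh
  have hx : ∀ x : X, (Pi.mulSingle x (Multiplicative.ofAdd (1 : ZMod p)) :
      X → Multiplicative (ZMod p)) = ElemGroup.gen p x := fun x => by
    funext y
    rw [Pi.mulSingle_apply]
    rfl
  exact ⟨f, fun x => (congrArg (fun s => f (MonoidAlgebra.of (ZMod p) _ s)) (hx x)).symm.trans (hf x)⟩

end GeneratingAlgebras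

/-! ### Letterwise and concatenation powers of words -/

section WordOperations

theorem wordPow_map {S S' : Type*} (φ : S → S') (w : List S) (n : ℕ) :
    (wordPow w n).map φ = wordPow (w.map φ) n := by
  simp [wordPow, List.map_flatten]

theorem letterPow_wordPow {S : Type*} [CommMonoid S] (p : ℕ) (w : List S) (n : ℕ) :
    letterPow p (wordPow w n) = wordPow (letterPow p w) n := wordPow_map _ w n

theorem wordPow_eq_append {S : Type*} (w : List S) {n : ℕ} (hn : 0 < n) :
    wordPow w n = w ++ wordPow w (n - 1) := by
  obtain ⟨m, rfl⟩ : ∃ m, n = m + 1 := ⟨n - 1, by omega⟩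
  simp [wordPow, List.replicate_succ]

theorem wordPow_inj {S : Type*} {w w' : List S} {n : ℕ} (hn : 0 < n)
    (hlen : w.length = w'.length) (h : wordPow w n = wordPow w' n) : w = w' := by
  rw [wordPow_eq_append w hn, wordPow_eq_append w' hn] at h
  exact (List.append_inj h hlen).1

theorem letterPow_wordPow_eq_self_iff {S : Type*} [CommMonoid S] {p : ℕ} (w : List S) {n : ℕ}
    (hn : 0 < n) : letterPow p (wordPow w n) = wordPow w n ↔ letterPow p w = w := by
  rw [letterPow_wordPow]
  exact ⟨wordPow_inj hn (by simp [letterPow]), fun h => by rw [h]⟩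

theorem opT_union {S : Type*} (p : ℕ) (V W : Set (List S)) : opT p (V ∪ W) = opT p V ∪ opT p W := by
  ext v
  simp only [opT, Set.mem_union, Set.mem_ofPred_eq, or_and_right, exists_or]

theorem opOne_union_opTwo {S : Type*} [CommMonoid S] (p : ℕ) (W : Set (List S)) :
    opOne p W ∪ opTwo p W = W := by
  ext w
  simp only [opOne, opTwo, Set.mem_union, Set.mem_ofPred_eq]
  tauto

theorem letterPow_eq_of_mem_opT_opOne {S : Type*} [CommMonoid S] {p : ℕ} {W : Set (List S)}
    {v : List S} (hv : v ∈ opT p (opOne p W)) : letterPow p v = v := by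
  obtain ⟨w, hw, i, rfl⟩ := hv
  rw [letterPow_wordPow, hw.2]

theorem letterPow_ne_of_mem_opT_opTwo {S : Type*} [CommMonoid S] {p : ℕ} (hp : 0 < p)
    {W : Set (List S)} {v : List S} (hv : v ∈ opT p (opTwo p W)) : letterPow p v ≠ v := by
  obtain ⟨w, hw, i, rfl⟩ := hv
  rw [Ne, letterPow_wordPow_eq_self_iff w (pow_pos hp i)]
  exact hw.2

theorem ne_nil_of_mem_setTL {S : Type*} [LinearOrder S] {p : ℕ} (hp : 0 < p) {v : List S}
    (hv : v ∈ setTL p S) : v ≠ [] := by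
  obtain ⟨w, hw, i, rfl⟩ := hv
  rw [wordPow_eq_append w (pow_pos hp i)]
  simp [hw.1]

theorem iterate_letterPow_wordPow {p : ℕ} {S : Type*} [CommMonoid S] (w : List S) (n j : ℕ) :
    (letterPow p)^[j] (wordPow w n) = wordPow ((letterPow p)^[j] w) n := by
  induction j with
  | zero => rfl
  | succ j ih => rw [Function.iterate_succ_apply', ih, letterPow_wordPow, Function.iterate_succ_apply']

theorem letterPow_of_mem_setW {p : ℕ} {S : Type*} [CommMonoid S] {w : List S} (hw : w ∈ setW p S) :
    letterPow p w = w := by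
  obtain ⟨i, rfl⟩ := hw
  rw [letterPow_wordPow]
  simp [letterPow]

variable {S : Type*} [LinearOrder S]

theorem List.map_lt_map {S' : Type*} [LinearOrder S'] {φ : S → S'} (hφ : StrictMono φ)
    {u v : List S} (h : u < v) : u.map φ < v.map φ := by
  induction h with
  | nil => exact List.Lex.nil
  | rel h => exact List.Lex.rel (hφ h)
  | cons _ ih => exact List.Lex.cons ih

theorem isLyndon_map_iff {S' : Type*} [LinearOrder S'] {φ : S → S'} (hφ : StrictMono φ)
    {w : List S} : IsLyndon (w.map φ) ↔ IsLyndon w := by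
  constructor
  · refine fun h => ⟨by simpa using h.1, fun u v hu hv huv => ?_⟩
    have h1 := h.2 (u.map φ) (v.map φ) (by simpa using hu) (by simpa using hv) (by simp [huv])
    change w < v
    by_contra hn
    rcases (not_lt.1 hn).eq_or_lt with rfl | h2
    · exact lt_irrefl (v.map φ) h1
    · exact lt_asymm h1 (List.map_lt_map hφ h2)
  · refine fun h => ⟨by simpa using h.1, fun u v hu hv huv => ?_⟩
    obtain ⟨u', v', rfl, rfl, rfl⟩ := List.map_eq_append_iff.1 huv
    exact List.map_lt_map hφ (h.2 u' v' (by simpa using hu) (by simpa using hv) rfl)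

theorem IsLyndon.eq_singleton_of_replicate {n : ℕ} {a : S} (h : IsLyndon (List.replicate n a)) :
    n = 1 := by
  obtain ⟨m, rfl⟩ : ∃ m, n = m + 1 := Nat.exists_eq_succ_of_ne_zero fun h0 => h.1 (by simp [h0])
  by_contra hm
  have h1 := h.2 [a] (List.replicate m a) (by simp) (by simp; omega) (by simp [List.replicate_succ])
  refine lt_asymm (show List.replicate (m + 1) a < List.replicate m a from h1) ?_
  rw [List.replicate_succ']
  exact List.lt_append_self (by simp)

/-- If `a` is the smallest letter, then `a ⋯ a` is the smallest word of its length. -/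
theorem List.replicate_length_lt {a : S} (ha : ∀ s, a ≤ s) {w : List S}
    (hw : w ≠ List.replicate w.length a) : List.replicate w.length a < w := by
  induction w with
  | nil => simp at hw
  | cons b w ih =>
    rw [List.length_cons, List.replicate_succ] at hw ⊢
    rcases (ha b).eq_or_lt with rfl | hb
    · exact List.Lex.cons (ih fun h => hw (by rw [← h]))
    · exact List.Lex.rel hb

end WordOperations

/-! ### Presentations of the mixable shuffle algebra -/

namespace MixableShuffle

variable {p : ℕ} [Fact p.Prime] {lam : ZMod p} {A : Type*} [CommRing A] [Algebra (ZMod p) A]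
  {S : Type*} [LinearOrder S] [WellFoundedLT S] [CommMonoid S]

/-- `Sh(A)` is presented by generators with leading words the elements of `T(L)` and one relation of
the form `y^p = (lower degree)` for each of them. -/
theorem exists_algEquiv_presentedAlg (b : Module.Basis S (ZMod p) A)
    (hb : ∀ s t, b (s * t) = b s * b t) {Y : Type*} {τ : Y → List S}
    (hτ : Function.Injective τ) (hr : Set.range τ = setTL p S)
    {g : Y → MixableShuffle (ZMod p) lam A} (hg : ∀ y, HasLead b (g y) 1 (LyndonWord.cfl (τ y)))
    {R : Y → MvPolynomial Y (ZMod p)} (hdeg : ∀ y, (MvPolynomial.X y ^ p - R y).totalDegree ≤ 1)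
    (hR : ∀ y, MvPolynomial.aeval g (R y) = 0) :
    ∃ e : MixableShuffle (ZMod p) lam A ≃ₐ[ZMod p] PresentedAlg (Set.range R),
      ∀ y, e (g y) = PresentedAlg.gen _ y := by
  obtain ⟨h1, h2⟩ := reducedMonomials_basis b hb hτ hr hg
  exact PresentedAlg.exists_algEquiv
    (fun y => (hdeg y).trans_lt (Fact.out : p.Prime).one_lt) hR h1 h2

end MixableShuffle

theorem wordScalar_eq_one {p : ℕ} [Fact p.Prime] {lam : ZMod p} (hlam : lam ≠ 0) {S : Type*}
    (w : List S) : wordScalar lam w = 1 := by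
  rw [wordScalar, mul_comm, pow_mul, ZMod.pow_card_sub_one_eq_one hlam, one_pow]

theorem MvPolynomial.totalDegree_C_mul_X_le {k Y : Type*} [CommRing k] (c : k) (y : Y) :
    (C c * X y : MvPolynomial Y k).totalDegree ≤ 1 := by
  rw [C_mul_X_eq_monomial]
  exact (totalDegree_monomial_le _ _).trans (by simp)

/-! ### Monomial bases of the generating algebras -/

section MonomialBases

variable {k : Type*} [CommRing k] {X : Type*}

/-- The monomial basis of `k[X]`, indexed by the free commutative monoid. -/
noncomputable def FreeCommMonoid.basis (k : Type*) [CommRing k] (X : Type*) :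
    Module.Basis (FreeCommMonoid X) k (MvPolynomial X k) :=
  (MvPolynomial.basisMonomials X k : Module.Basis (X →₀ ℕ) k (MvPolynomial X k))

theorem FreeCommMonoid.coe_basis : ⇑(FreeCommMonoid.basis k X) = FreeCommMonoid.toPoly k :=
  MvPolynomial.coe_basisMonomials _ _

theorem FreeCommMonoid.toPoly_mul (s t : FreeCommMonoid X) :
    toPoly k (s * t) = toPoly k s * toPoly k t := by
  unfold toPoly
  rw [MvPolynomial.monomial_mul, one_mul]
  rfl

theorem FreeCommMonoid.pow_eq_self_iff {p : ℕ} (hp : 1 < p) {s : FreeCommMonoid X} :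
    s ^ p = s ↔ s = 1 := by
  refine ⟨fun h => ?_, fun h => by rw [h, one_pow]⟩
  have h1 : p • (show X →₀ ℕ from s) = (show X →₀ ℕ from s) := h
  change (show X →₀ ℕ from s) = 0
  ext x
  have h2 := DFunLike.congr_fun h1 x
  change p * (show X →₀ ℕ from s) x = (show X →₀ ℕ from s) x at h2
  by_contra h3
  have := Nat.eq_of_mul_eq_mul_right (Nat.pos_of_ne_zero h3) (h2.trans (one_mul _).symm)
  omega

/-- The basis `f S` of an algebra isomorphic to `k[S]` by `f`. -/
noncomputable def MonoidAlgebra.mapBasis {S : Type*} [Monoid S] {A : Type*} [CommRing A]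
    [Algebra k A] (f : MonoidAlgebra k S ≃ₐ[k] A) : Module.Basis S k A :=
  (Finsupp.basisSingleOne.map (MonoidAlgebra.coeffLinearEquiv k).symm).map f.toLinearEquiv

theorem MonoidAlgebra.coe_mapBasis {S : Type*} [Monoid S] {A : Type*} [CommRing A]
    [Algebra k A] (f : MonoidAlgebra k S ≃ₐ[k] A) :
    ⇑(MonoidAlgebra.mapBasis f) = fun s => f (MonoidAlgebra.of k S s) := by
  funext s
  simp [mapBasis]

end MonomialBases

/-! ### Generating algebras `F_p[X]` in weight zero and `F_p[X] / ⟨x^p - x⟩` -/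

open MvPolynomial in
/-- In weight zero every non-empty word has `p`-th power zero. -/
theorem freeCommRotaBaxter_weight_zero (p : ℕ) [Fact p.Prime] (X : Type*)
    [LinearOrder (FreeCommMonoid X)] [WellFoundedLT (FreeCommMonoid X)] :
    ∃ e : FreeCommRotaBaxter (ZMod p) 0 (MvPolynomial X (ZMod p)) ≃ₐ[ZMod p]
          MvPolynomial X (ZMod p) ⊗[ZMod p] TruncAlg p (setTL p (FreeCommMonoid X)),
        (∀ a : MvPolynomial X (ZMod p), e (a ⊗ₜ 1) = a ⊗ₜ 1) ∧
        ∀ w : setTL p (FreeCommMonoid X),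
          e (1 ⊗ₜ MixableShuffle.word 0 (FreeCommMonoid.toPoly (ZMod p)) w.1) =
            1 ⊗ₜ PresentedAlg.gen _ w := by
  have hp : p.Prime := Fact.out
  rw [← FreeCommMonoid.coe_basis]
  obtain ⟨e, he⟩ := MixableShuffle.exists_algEquiv_presentedAlg (lam := (0 : ZMod p))
    (FreeCommMonoid.basis (ZMod p) X)
    (by simpa only [FreeCommMonoid.coe_basis] using FreeCommMonoid.toPoly_mul)
    (Y := setTL p (FreeCommMonoid X)) (τ := Subtype.val) Subtype.val_injective Subtype.range_val
    (g := fun w => MixableShuffle.word 0 (FreeCommMonoid.basis (ZMod p) X) w.1)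
    (fun w => MixableShuffle.hasLead_word w.1)
    (R := fun y => MvPolynomial.X y ^ p) (by simp) (fun w => by
      rw [map_pow, MvPolynomial.aeval_X,
        MixableShuffle.word_pow_zero _ (ne_nil_of_mem_setTL hp.pos w.2)])
  refine ⟨Algebra.TensorProduct.congr AlgEquiv.refl e, fun a => ?_, fun w => ?_⟩
  · rw [Algebra.TensorProduct.congr_apply, Algebra.TensorProduct.map_tmul, map_one]
    rfl
  · rw [Algebra.TensorProduct.congr_apply, Algebra.TensorProduct.map_tmul, map_one]
    exact congrArg _ (he w)

theorem IdemMonoid.pow_eq_self {p : ℕ} [Fact p.Prime] {X : Type*} (s : IdemMonoid p X) :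
    s ^ p = s := by
  have hpp : p - 1 + 1 = p := by have := (Fact.out : p.Prime).two_le; omega
  have key : ∀ z : WithOne (Multiplicative (ZMod (p - 1))), z ^ p = z := by
    intro z
    rcases z with _ | z
    · exact one_pow p
    · have h := WithOne.coe_pow_succ z (p - 1)
      have h1 : z ^ (p - 1) = 1 := by
        change (p - 1) • (Multiplicative.toAdd z) = 0
        rw [nsmul_eq_mul, ZMod.natCast_self, zero_mul]
      rw [pow_succ z, h1, one_mul, hpp] at h
      exact h
  exact funext fun x => key (s x)

theorem IdemMonoid.finite {p : ℕ} [Fact p.Prime] {X : Type*} [Finite X] :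
    Finite (IdemMonoid p X) := by
  have : NeZero (p - 1) := ⟨by have := (Fact.out : p.Prime).two_le; omega⟩
  have : Finite (WithOne (Multiplicative (ZMod (p - 1)))) :=
    inferInstanceAs (Finite (Option (Multiplicative (ZMod (p - 1)))))
  exact inferInstanceAs (Finite (X → WithOne (Multiplicative (ZMod (p - 1)))))

theorem ElemGroup.pow_eq_one {p : ℕ} {X : Type*} (s : ElemGroup p X) : s ^ p = 1 := by
  have key : ∀ z : Multiplicative (ZMod p), z ^ p = 1 := by
    intro z
    change p • (Multiplicative.toAdd z) = 0
    rw [nsmul_eq_mul, ZMod.natCast_self, zero_mul]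
  exact funext fun x => key (s x)

theorem ElemGroup.finite {p : ℕ} [Fact p.Prime] {X : Type*} [Finite X] :
    Finite (ElemGroup p X) :=
  inferInstanceAs (Finite (X → Multiplicative (ZMod p)))

open MvPolynomial in
/-- The `p`-th power fixes all letters and hence all words, so that `E` imposes no condition. -/
theorem freeCommRotaBaxter_idemAlg (p : ℕ) [Fact p.Prime] (X : Type*) [Finite X]
    (f : MonoidAlgebra (ZMod p) (IdemMonoid p X) ≃ₐ[ZMod p] IdemAlg p X) {lam : ZMod p}
    (hlam : lam ≠ 0) [LinearOrder (IdemMonoid p X)] :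
    ∃ e : FreeCommRotaBaxter (ZMod p) lam (IdemAlg p X) ≃ₐ[ZMod p]
          TwistAlg p (Sum.elim (fun _ : X => (1 : ZMod p))
            (fun w : setTEL p (IdemMonoid p X) => wordScalar lam w.1)),
        (∀ x : X, e (PresentedAlg.gen _ x ⊗ₜ 1) =
          PresentedAlg.gen _ (Sum.inl x)) ∧
        ∀ w : setTEL p (IdemMonoid p X),
          e (1 ⊗ₜ MixableShuffle.word lam
              (fun s => f (MonoidAlgebra.of (ZMod p) (IdemMonoid p X) s)) w.1) =
            PresentedAlg.gen _ (Sum.inr w) := by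
  have hp : p.Prime := Fact.out
  have hpow : ∀ s : IdemMonoid p X, s ^ p = s := IdemMonoid.pow_eq_self
  have hlp : ∀ w : List (IdemMonoid p X), letterPow p w = w := fun w => by simp [letterPow, hpow]
  have hTEL : setTEL p (IdemMonoid p X) = setTL p (IdemMonoid p X) := by
    unfold setTEL setTL
    congr 1
    ext w
    simp [opE, hlp]
  have : Finite (IdemMonoid p X) := IdemMonoid.finite
  rw [← MonoidAlgebra.coe_mapBasis]
  have hmul : ∀ s t, MonoidAlgebra.mapBasis f (s * t) =
      MonoidAlgebra.mapBasis f s * MonoidAlgebra.mapBasis f t := by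
    intro s t
    simp only [MonoidAlgebra.coe_mapBasis, map_mul]
  obtain ⟨e, he⟩ := MixableShuffle.exists_algEquiv_presentedAlg (lam := lam)
    (MonoidAlgebra.mapBasis f) hmul
    (Y := setTEL p (IdemMonoid p X)) (τ := Subtype.val) Subtype.val_injective
    (by rw [Subtype.range_val, hTEL])
    (g := fun w => MixableShuffle.word lam (MonoidAlgebra.mapBasis f) w.1)
    (fun w => MixableShuffle.hasLead_word w.1)
    (R := fun w => MvPolynomial.X w ^ p - C (wordScalar lam w.1) * MvPolynomial.X w)
    (fun w => by
      rw [sub_sub_cancel]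
      exact MvPolynomial.totalDegree_C_mul_X_le _ _) (fun w => by
      rw [map_sub, map_mul, map_pow, MvPolynomial.aeval_X, wordScalar_eq_one hlam,
        MixableShuffle.word_pow hlam, hlp, map_one, map_one, one_mul, sub_self]
      intro s
      simp only [MonoidAlgebra.coe_mapBasis, map_pow])
  obtain ⟨e', h1, h2⟩ := PresentedAlg.exists_tensor_algEquiv (k := ZMod p)
    (R := fun y : X ⊕ setTEL p (IdemMonoid p X) => MvPolynomial.X y ^ p -
      C (Sum.elim (fun _ : X => (1 : ZMod p)) (fun w => wordScalar lam w.1) y) * MvPolynomial.X y)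
    (R₁ := fun x : X => MvPolynomial.X x ^ p - MvPolynomial.X x)
    (R₂ := fun w : setTEL p (IdemMonoid p X) =>
      MvPolynomial.X w ^ p - C (wordScalar lam w.1) * MvPolynomial.X w)
    (fun x => by simp) (fun w => by simp)
  refine ⟨(Algebra.TensorProduct.congr AlgEquiv.refl e).trans e'.symm, fun x => ?_, fun w => ?_⟩
  · rw [AlgEquiv.trans_apply, AlgEquiv.symm_apply_eq, h1, Algebra.TensorProduct.congr_apply,
      Algebra.TensorProduct.map_tmul, map_one]
    rfl
  · rw [AlgEquiv.trans_apply, AlgEquiv.symm_apply_eq, h2, Algebra.TensorProduct.congr_apply,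
      Algebra.TensorProduct.map_tmul, map_one]
    exact congrArg _ (he w)

/-! ### Generating algebras of exponent `p` -/

open MvPolynomial in
/-- The shuffle algebra of the group algebra of a group of exponent `p`: the words fixed by the
letterwise `p`-th power are equal to their `p`-th powers, and `w - w^{(p)}` has `p`-th power zero. -/
theorem MixableShuffle.exists_algEquiv_of_pow_eq_one {p : ℕ} [Fact p.Prime] {lam : ZMod p}
    (hlam : lam ≠ 0) {A : Type*} [CommRing A] [Algebra (ZMod p) A] {S : Type*} [CommMonoid S]
    [LinearOrder S] [WellFoundedLT S] (hS : ∀ s : S, s ^ p = 1) (h1 : ∀ s : S, 1 ≤ s)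
    (b : Module.Basis S (ZMod p) A) (hmul : ∀ s t, b (s * t) = b s * b t)
    (hpow : ∀ s, b (s ^ p) = b s ^ p) :
    ∃ e : MixableShuffle (ZMod p) lam A ≃ₐ[ZMod p]
        TwistAlg p (fun w : setTL₁ p S => wordScalar lam w.1) ⊗[ZMod p]
          TruncAlg p (setTL₂Diff p lam b),
      (∀ w : setTL₁ p S, e (MixableShuffle.word lam b w.1) = PresentedAlg.gen _ w ⊗ₜ 1) ∧
      ∀ z : setTL₂Diff p lam b, e z.1 = 1 ⊗ₜ PresentedAlg.gen _ z := by
  have hp : p.Prime := Fact.out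
  have hlp : ∀ w : List S, letterPow p w = List.replicate w.length 1 := fun w => by
    simp [letterPow, hS]
  -- `t z` is the word `w` for which `z = w - w^{(p)}`
  choose t ht htz using fun z : setTL₂Diff p lam b => z.2
  have hTL : setTL p (S) = setTL₁ p (S) ∪ setTL₂ p (S) := by
    rw [setTL, setTL₁, setTL₂, ← opT_union, opOne_union_opTwo]
  let τ : setTL₁ p (S) ⊕ setTL₂Diff p lam b → List (S) :=
    Sum.elim Subtype.val t
  have hτ : Function.Injective τ := by
    refine Subtype.val_injective.sumElim ?_ ?_
    · intro z z' h
      exact Subtype.ext (by rw [htz z, htz z', h])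
    · intro w z h
      refine letterPow_ne_of_mem_opT_opTwo hp.pos (ht z) ?_
      rw [← h]
      exact letterPow_eq_of_mem_opT_opOne w.2
  have ht2 : ∀ w ∈ setTL₂ p (S), ∃ z, t z = w := by
    intro w hw
    refine ⟨⟨_, w, hw, rfl⟩, ?_⟩
    refine MixableShuffle.eq_of_word_sub_word_eq b (htz ⟨_, w, hw, rfl⟩)
      (letterPow_ne_of_mem_opT_opTwo hp.pos hw) fun h => ?_
    refine letterPow_ne_of_mem_opT_opTwo hp.pos hw ?_
    rw [← h, hlp, hlp, List.length_replicate]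
  have hr : Set.range τ = setTL p (S) := by
    rw [Set.Sum.elim_range, Subtype.range_val, hTL]
    congr 1
    ext w
    refine ⟨?_, fun hw => ht2 w hw⟩
    rintro ⟨z, rfl⟩
    exact ht z
  let g : setTL₁ p (S) ⊕ setTL₂Diff p lam b → MixableShuffle (ZMod p) lam (A) :=
    Sum.elim (fun w => MixableShuffle.word lam b w.1) Subtype.val
  have hg : ∀ y, MixableShuffle.HasLead b (g y) 1 (LyndonWord.cfl (τ y)) := by
    rintro (w | z)
    · exact MixableShuffle.hasLead_word w.1
    -- `w^{(p)}` consists of letters `1`, so it precedes `w`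
    · change z.1 - (1 : ZMod p) • MixableShuffle.word lam b (LyndonWord.wd (LyndonWord.cfl (t z))) ∈
        MixableShuffle.below lam b (LyndonWord.wd (LyndonWord.cfl (t z)))
      rw [LyndonWord.wd_cfl, htz z, one_smul, sub_sub_cancel_left]
      refine neg_mem (MixableShuffle.word_mem_below (List.Shortlex.of_lex (by simp [letterPow]) ?_))
      rw [hlp]
      refine List.replicate_length_lt h1 fun h => ?_
      exact letterPow_ne_of_mem_opT_opTwo hp.pos (ht z) ((hlp _).trans h.symm)
  let R₁ : setTL₁ p (S) → MvPolynomial (setTL₁ p (S)) (ZMod p) :=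
    fun w => MvPolynomial.X w ^ p - C (wordScalar lam w.1) * MvPolynomial.X w
  let R₂ : setTL₂Diff p lam b → MvPolynomial (setTL₂Diff p lam b) (ZMod p) :=
    fun z => MvPolynomial.X z ^ p
  let R : setTL₁ p (S) ⊕ setTL₂Diff p lam b → MvPolynomial _ (ZMod p) :=
    Sum.elim (fun w => rename Sum.inl (R₁ w)) (fun z => rename Sum.inr (R₂ z))
  obtain ⟨e, he⟩ := MixableShuffle.exists_algEquiv_presentedAlg b hmul hτ hr hg (R := R) (by
      rintro (w | z)
      · simp only [R, R₁, Sum.elim_inl, map_sub, map_pow, map_mul, rename_X, rename_C]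
        rw [sub_sub_cancel]
        exact MvPolynomial.totalDegree_C_mul_X_le _ _
      · simp [R, R₂]) (by
      rintro (w | z)
      · simp only [R, R₁, Sum.elim_inl, map_sub, map_pow, map_mul, rename_X, rename_C, aeval_X]
        rw [wordScalar_eq_one hlam, map_one, map_one, one_mul]
        change MixableShuffle.word lam b w.1 ^ p - MixableShuffle.word lam b w.1 = 0
        rw [MixableShuffle.word_pow hlam hpow, letterPow_eq_of_mem_opT_opOne w.2, sub_self]
      · simp only [R, R₂, Sum.elim_inr, map_pow, rename_X, aeval_X]
        change z.1 ^ p = 0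
        rw [htz z, ZMod.sub_pow_prime, MixableShuffle.word_pow hlam hpow,
          MixableShuffle.word_pow hlam hpow, hlp (letterPow p _), hlp]
        simp)
  obtain ⟨e', h2, h3⟩ := PresentedAlg.exists_tensor_algEquiv (R := R) (R₁ := R₁) (R₂ := R₂)
    (fun _ => rfl) (fun _ => rfl)
  exact ⟨e.trans e', fun w => (congrArg e' (he (Sum.inl w))).trans (h2 w),
    fun z => (congrArg e' (he (Sum.inr z))).trans (h3 z)⟩

/-- The free commutative Rota-Baxter algebra of the group algebra of a group of exponent `p`. The basis
`b` and the homomorphism `φ` have the same underlying map `f`. -/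
theorem FreeCommRotaBaxter.exists_algEquiv_of_pow_eq_one {p : ℕ} [Fact p.Prime] {lam : ZMod p}
    (hlam : lam ≠ 0) {A : Type*} [CommRing A] [Algebra (ZMod p) A] {S : Type*} [CommMonoid S]
    [LinearOrder S] [WellFoundedLT S] (hS : ∀ s : S, s ^ p = 1) (h1 : ∀ s : S, 1 ≤ s)
    (φ : S →* A) (b : Module.Basis S (ZMod p) A) (f : S → A) (hb : b = f) (hf : φ = f) :
    ∃ e : FreeCommRotaBaxter (ZMod p) lam A ≃ₐ[ZMod p]
        A ⊗[ZMod p] (TwistAlg p (fun w : setTL₁ p S => wordScalar lam w.1) ⊗[ZMod p]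
          TruncAlg p (setTL₂Diff p lam f)),
      (∀ a : A, e (a ⊗ₜ 1) = a ⊗ₜ 1) ∧
      (∀ w : setTL₁ p S, e (1 ⊗ₜ MixableShuffle.word lam f w.1) =
        1 ⊗ₜ (PresentedAlg.gen _ w ⊗ₜ 1)) ∧
      ∀ z : setTL₂Diff p lam f, e (1 ⊗ₜ z.1) = 1 ⊗ₜ (1 ⊗ₜ PresentedAlg.gen _ z) := by
  subst hb
  obtain ⟨e, h2, h3⟩ := MixableShuffle.exists_algEquiv_of_pow_eq_one hlam hS h1 b
    (fun s t => by rw [← hf, map_mul]) (fun s => by rw [← hf, map_pow])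
  refine ⟨Algebra.TensorProduct.congr AlgEquiv.refl e, fun a => ?_, fun w => ?_, fun z => ?_⟩
  · rw [Algebra.TensorProduct.congr_apply, Algebra.TensorProduct.map_tmul, map_one]
    rfl
  · rw [Algebra.TensorProduct.congr_apply, Algebra.TensorProduct.map_tmul, map_one]
    exact congrArg _ (h2 w)
  · rw [Algebra.TensorProduct.congr_apply, Algebra.TensorProduct.map_tmul, map_one]
    exact congrArg _ (h3 z)

theorem freeCommRotaBaxter_elemAlg (p : ℕ) [Fact p.Prime] (X : Type*) [Finite X]
    (f : MonoidAlgebra (ZMod p) (ElemGroup p X) ≃ₐ[ZMod p] ElemAlg p X) {lam : ZMod p}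
    (hlam : lam ≠ 0) [LinearOrder (ElemGroup p X)] (h1 : ∀ s : ElemGroup p X, 1 ≤ s) :
    ∃ e : FreeCommRotaBaxter (ZMod p) lam (ElemAlg p X) ≃ₐ[ZMod p]
          ElemAlg p X ⊗[ZMod p]
            (TwistAlg p (fun w : setTL₁ p (ElemGroup p X) => wordScalar lam w.1) ⊗[ZMod p]
              TruncAlg p (setTL₂Diff p lam
                (fun s => f (MonoidAlgebra.of (ZMod p) (ElemGroup p X) s)))),
        (∀ a : ElemAlg p X, e (a ⊗ₜ 1) = a ⊗ₜ 1) ∧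
        (∀ w : setTL₁ p (ElemGroup p X),
          e (1 ⊗ₜ MixableShuffle.word lam
              (fun s => f (MonoidAlgebra.of (ZMod p) (ElemGroup p X) s)) w.1) =
            1 ⊗ₜ (PresentedAlg.gen _ w ⊗ₜ 1)) ∧
        ∀ z : setTL₂Diff p lam (fun s => f (MonoidAlgebra.of (ZMod p) (ElemGroup p X) s)),
          e (1 ⊗ₜ z.1) = 1 ⊗ₜ (1 ⊗ₜ PresentedAlg.gen _ z) := by
  have : Finite (ElemGroup p X) := ElemGroup.finite
  exact FreeCommRotaBaxter.exists_algEquiv_of_pow_eq_one hlam ElemGroup.pow_eq_one h1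
    ((f : MonoidAlgebra (ZMod p) (ElemGroup p X) →* ElemAlg p X).comp (MonoidAlgebra.of _ _))
    (MonoidAlgebra.mapBasis f) _ (MonoidAlgebra.coe_mapBasis f) rfl

/-! ### Generating algebra `F_p[X]` in non-zero weight -/

section FrobeniusOrbits

variable {p : ℕ} [Fact p.Prime] {X : Type*}

/-- The degree of a monomial. -/
noncomputable def FreeCommMonoid.degree (s : FreeCommMonoid X) : ℕ :=
  Finsupp.degree (Multiplicative.toAdd (show Multiplicative (X →₀ ℕ) from s))

theorem FreeCommMonoid.degree_pow (s : FreeCommMonoid X) (n : ℕ) : degree (s ^ n) = n * degree s :=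
  map_nsmul (Finsupp.degree : (X →₀ ℕ) →+ ℕ) n _

theorem FreeCommMonoid.degree_eq_zero {s : FreeCommMonoid X} (h : degree s = 0) : s = 1 :=
  (Finsupp.degree_eq_zero_iff _).1 h

/-- The total degree of a word over the free commutative monoid. -/
noncomputable def FreeCommMonoid.wordDegree (w : List (FreeCommMonoid X)) : ℕ :=
  (w.map degree).sum

theorem FreeCommMonoid.wordDegree_letterPow (p : ℕ) (w : List (FreeCommMonoid X)) :
    wordDegree (letterPow p w) = p * wordDegree w := by
  induction w with
  | nil => rfl
  | cons s w ih =>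
    change degree (s ^ p) + wordDegree (letterPow p w) = p * (degree s + wordDegree w)
    rw [ih, degree_pow, mul_add]

theorem FreeCommMonoid.wordDegree_eq_zero {w : List (FreeCommMonoid X)} (h : wordDegree w = 0) :
    w = List.replicate w.length 1 := by
  rw [List.eq_replicate_iff]
  refine ⟨rfl, fun s hs => ?_⟩
  exact degree_eq_zero (List.sum_eq_zero_iff.1 h _ (List.mem_map_of_mem hs))

variable [LinearOrder (FreeCommMonoid X)]

/-- Under the letterwise `p`-th power every Lyndon word that is not fixed arises from a Lyndon
word that is no such power. -/
theorem FreeCommMonoid.exists_iterate_letterPow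
    (hmono : StrictMono fun s : FreeCommMonoid X => s ^ p) {l : List (FreeCommMonoid X)}
    (hl : l ∈ opTwo p (setL (FreeCommMonoid X))) :
    ∃ u ∈ opE p (opTwo p (setL (FreeCommMonoid X))), ∃ j : ℕ, l = (letterPow p)^[j] u := by
  induction hN : wordDegree l using Nat.strong_induction_on generalizing l with
  | _ N ih =>
  subst hN
  by_cases h : ∃ u, l = letterPow p u
  · obtain ⟨u, rfl⟩ := h
    have hne : letterPow p u ≠ u := fun h => hl.2 (by rw [h, h])
    have hdeg : wordDegree u < wordDegree (letterPow p u) := by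
      rw [wordDegree_letterPow]
      refine lt_mul_left (Nat.pos_of_ne_zero fun h0 => hne ?_) (Fact.out : p.Prime).one_lt
      rw [wordDegree_eq_zero h0]
      simp [letterPow]
    obtain ⟨v, hv, j, rfl⟩ := ih _ hdeg ⟨(isLyndon_map_iff hmono).1 hl.1, hne⟩ rfl
    exact ⟨v, hv, j + 1, (Function.iterate_succ_apply' _ _ _).symm⟩
  · exact ⟨l, ⟨hl, Or.inr fun u hu => h ⟨u, hu⟩⟩, 0, rfl⟩

/-- The only Lyndon word over the free commutative monoid with all letters fixed by the `p`-th power is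
`1`. -/
theorem FreeCommMonoid.eq_singleton_one_of_isLyndon {l : List (FreeCommMonoid X)}
    (hl : IsLyndon l) (h : letterPow p l = l) : l = [1] := by
  have h1 : l = List.replicate l.length 1 := by
    rw [List.eq_replicate_iff]
    refine ⟨rfl, fun s hs => ?_⟩
    rw [← FreeCommMonoid.pow_eq_self_iff (Fact.out : p.Prime).one_lt]
    exact List.map_eq_map_iff.1 (h.trans (List.map_id l).symm) s hs
  rw [h1] at hl
  rw [h1, hl.eq_singleton_of_replicate]
  rfl

/-- If a concatenation power of `w` is a letterwise `p`-th power, then so is its prefix `w`. -/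
theorem ne_letterPow_of_mem_setTEL₂ {S : Type*} [CommMonoid S] [LinearOrder S]
    {v : List S} (hv : v ∈ setTEL₂ p S) (u : List S) : v ≠ letterPow p u := by
  obtain ⟨w, ⟨hw, hw'⟩, i, rfl⟩ := hv
  have hw2 := hw'.resolve_left fun h => hw.2 h.symm
  intro h
  refine hw2 (u.take w.length) ?_
  rw [letterPow, List.map_take]
  change w = List.take w.length (letterPow p u)
  rw [← h, wordPow_eq_append w (pow_pos (Fact.out : p.Prime).pos i), List.take_left]

variable (p X) in
/-- The indexing of `T(L)` by the letterwise powers of the words in `T(E(L₂))` and by the powers of the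
one-letter word `1`. -/
noncomputable def FreeCommMonoid.orbitWord :
    (setTEL₂ p (FreeCommMonoid X) × ℕ) ⊕ setW p (FreeCommMonoid X) → List (FreeCommMonoid X) :=
  Sum.elim (fun y => (letterPow p)^[y.2] y.1.1) Subtype.val

theorem FreeCommMonoid.orbitWord_injective
    (hmono : StrictMono fun s : FreeCommMonoid X => s ^ p) :
    Function.Injective (orbitWord p X) := by
  have hinj : Function.Injective (letterPow p : List (FreeCommMonoid X) → _) :=
    List.map_injective_iff.2 hmono.injective
  have key : ∀ (u u' : setTEL₂ p (FreeCommMonoid X)) (j d : ℕ),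
      (letterPow p)^[j] u.1 = (letterPow p)^[j + d] u'.1 → d = 0 ∧ u = u' := by
    intro u u' j d h
    rw [Function.iterate_add_apply] at h
    have h1 := hinj.iterate j h
    rcases d with _ | d
    · exact ⟨rfl, Subtype.ext h1⟩
    · rw [Function.iterate_succ_apply'] at h1
      exact absurd h1 (ne_letterPow_of_mem_setTEL₂ u.2 _)
  refine Function.Injective.sumElim ?_ Subtype.val_injective ?_
  · rintro ⟨u, j⟩ ⟨u', j'⟩ h
    rcases le_total j j' with hj | hj
    · obtain ⟨d, rfl⟩ := exists_add_of_le hj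
      obtain ⟨rfl, rfl⟩ := key u u' j d h
      rfl
    · obtain ⟨d, rfl⟩ := exists_add_of_le hj
      obtain ⟨rfl, rfl⟩ := key u' u j' d h.symm
      rfl
  · rintro ⟨u, j⟩ w h
    have hw := letterPow_of_mem_setW w.2
    have h1 : (letterPow p)^[j] u.1 = (letterPow p)^[j] w.1 := by
      rw [Function.iterate_fixed hw]
      exact h
    exact ne_letterPow_of_mem_setTEL₂ u.2 w.1 ((hinj.iterate j h1).trans hw.symm)

theorem FreeCommMonoid.range_orbitWord (hmono : StrictMono fun s : FreeCommMonoid X => s ^ p) :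
    Set.range (orbitWord p X) = setTL p (FreeCommMonoid X) := by
  ext v
  constructor
  · rintro ⟨⟨⟨u, w, hw, i, rfl⟩, j⟩ | ⟨w, i, rfl⟩, rfl⟩
    · refine ⟨(letterPow p)^[j] w, ?_, i, iterate_letterPow_wordPow w _ j⟩
      have hw1 : IsLyndon w := hw.1.1
      clear hw
      change IsLyndon _
      induction j with
      | zero => exact hw1
      | succ j ih =>
        rw [Function.iterate_succ_apply']
        exact (isLyndon_map_iff hmono).2 ih
    · exact ⟨[1], isLyndon_singleton 1, i, rfl⟩
  · rintro ⟨l, hl, i, rfl⟩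
    by_cases h : letterPow p l = l
    · obtain rfl := eq_singleton_one_of_isLyndon hl h
      exact ⟨Sum.inr ⟨_, i, rfl⟩, rfl⟩
    · obtain ⟨u, hu, j, rfl⟩ := exists_iterate_letterPow hmono ⟨hl, h⟩
      exact ⟨Sum.inl (⟨_, u, hu, i, rfl⟩, j), iterate_letterPow_wordPow u _ j⟩

end FrobeniusOrbits

open MvPolynomial in
/-- Each orbit of the letterwise `p`-th power on `T(L₂)` starts in `T(E(L₂))` and yields one free
variable; the fixed words are the `1^{⊗ p^i}`. -/
theorem freeCommRotaBaxter_mvPolynomial (p : ℕ) [Fact p.Prime] (X : Type*) {lam : ZMod p}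
    (hlam : lam ≠ 0) [LinearOrder (FreeCommMonoid X)] (hG : InClassG p (FreeCommMonoid X)) :
      ∃ e : FreeCommRotaBaxter (ZMod p) lam (MvPolynomial X (ZMod p)) ≃ₐ[ZMod p]
          MvPolynomial (X ⊕ setTEL₂ p (FreeCommMonoid X)) (ZMod p) ⊗[ZMod p]
            TwistAlg p (fun w : setW p (FreeCommMonoid X) => wordScalar lam w.1),
        (∀ x : X, e (MvPolynomial.X x ⊗ₜ 1) = MvPolynomial.X (Sum.inl x) ⊗ₜ 1) ∧
        (∀ w : setTEL₂ p (FreeCommMonoid X),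
          e (1 ⊗ₜ MixableShuffle.word lam (FreeCommMonoid.toPoly (ZMod p)) w.1) =
            MvPolynomial.X (Sum.inr w) ⊗ₜ 1) ∧
        ∀ w : setW p (FreeCommMonoid X),
          e (1 ⊗ₜ MixableShuffle.word lam (FreeCommMonoid.toPoly (ZMod p)) w.1) =
            1 ⊗ₜ PresentedAlg.gen _ w := by
  have := hG.wellFoundedLT
  have hmono : StrictMono fun s : FreeCommMonoid X => s ^ p := fun a b h => hG.pow_lt_pow b a h
  rw [← FreeCommMonoid.coe_basis]
  set b := FreeCommMonoid.basis (ZMod p) X with hb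
  have hmul : ∀ s t, b (s * t) = b s * b t := by
    simpa only [hb, FreeCommMonoid.coe_basis] using FreeCommMonoid.toPoly_mul
  have hb1 : b 1 = 1 := by
    rw [hb, FreeCommMonoid.coe_basis]
    rfl
  have hpow : ∀ s, b (s ^ p) = b s ^ p := fun s =>
    map_pow (⟨⟨b, hb1⟩, hmul⟩ : FreeCommMonoid X →* MvPolynomial X (ZMod p)) s p
  let T := setTEL₂ p (FreeCommMonoid X)
  let R₁ : T × ℕ → MvPolynomial (T × ℕ) (ZMod p) :=
    fun y => MvPolynomial.X y ^ p - MvPolynomial.X (y.1, y.2 + 1)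
  let R₂ : setW p (FreeCommMonoid X) → MvPolynomial (setW p (FreeCommMonoid X)) (ZMod p) :=
    fun w => MvPolynomial.X w ^ p - C (wordScalar lam w.1) * MvPolynomial.X w
  let R : (T × ℕ) ⊕ setW p (FreeCommMonoid X) → MvPolynomial _ (ZMod p) :=
    Sum.elim (fun w => rename Sum.inl (R₁ w)) (fun z => rename Sum.inr (R₂ z))
  obtain ⟨e, he⟩ := MixableShuffle.exists_algEquiv_presentedAlg b hmul
    (FreeCommMonoid.orbitWord_injective hmono) (FreeCommMonoid.range_orbitWord hmono)
    (g := fun y => MixableShuffle.word lam b (FreeCommMonoid.orbitWord p X y))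
    (fun y => MixableShuffle.hasLead_word _) (R := R) (by
      rintro (y | w)
      · simp only [R, R₁, Sum.elim_inl, map_sub, map_pow, rename_X]
        rw [sub_sub_cancel]
        exact (totalDegree_X _).le
      · simp only [R, R₂, Sum.elim_inr, map_sub, map_pow, map_mul, rename_X, rename_C]
        rw [sub_sub_cancel]
        exact MvPolynomial.totalDegree_C_mul_X_le _ _) (by
      rintro (y | w)
      · simp only [R, R₁, Sum.elim_inl, map_sub, map_pow, rename_X, aeval_X]
        rw [MixableShuffle.word_pow hlam hpow, sub_eq_zero]
        congr 1
        exact (Function.iterate_succ_apply' _ _ _).symm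
      · simp only [R, R₂, Sum.elim_inr, map_sub, map_pow, map_mul, rename_X, rename_C, aeval_X]
        rw [wordScalar_eq_one hlam, map_one, map_one, one_mul, MixableShuffle.word_pow hlam hpow]
        change MixableShuffle.word lam b (letterPow p w.1) - MixableShuffle.word lam b w.1 = 0
        rw [letterPow_of_mem_setW w.2, sub_self])
  obtain ⟨e₁, h₁, h₂⟩ := PresentedAlg.exists_tensor_algEquiv (R := R) (R₁ := R₁) (R₂ := R₂)
    (fun _ => rfl) (fun _ => rfl)
  obtain ⟨e₂, h₃⟩ := PresentedAlg.exists_mvPolynomial_algEquiv (ZMod p) T p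
  let Tw := TwistAlg p (fun w : setW p (FreeCommMonoid X) => wordScalar lam w.1)
  -- the relations `y_{w, j}^p = y_{w, j+1}` eliminate all variables of an orbit but the first
  let E₁ : MixableShuffle (ZMod p) lam (MvPolynomial X (ZMod p)) ≃ₐ[ZMod p]
      MvPolynomial T (ZMod p) ⊗[ZMod p] Tw :=
    (e.trans e₁).trans (Algebra.TensorProduct.congr e₂ AlgEquiv.refl)
  have hE₁ : ∀ w : T, E₁ (MixableShuffle.word lam b w.1) = MvPolynomial.X w ⊗ₜ 1 := by
    intro w
    have h0 : e (MixableShuffle.word lam b w.1) = _ := he (Sum.inl (w, 0))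
    change Algebra.TensorProduct.congr e₂ AlgEquiv.refl (e₁ (e _)) = _
    rw [h0, h₁, Algebra.TensorProduct.congr_apply,
      Algebra.TensorProduct.map_tmul]
    exact congrArg₂ _ (h₃ w) rfl
  have hE₂ : ∀ w : setW p (FreeCommMonoid X), E₁ (MixableShuffle.word lam b w.1) =
      1 ⊗ₜ PresentedAlg.gen _ w := by
    intro w
    have h0 : e (MixableShuffle.word lam b w.1) = _ := he (Sum.inr w)
    change Algebra.TensorProduct.congr e₂ AlgEquiv.refl (e₁ (e _)) = _
    rw [h0, h₂, Algebra.TensorProduct.congr_apply,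
      Algebra.TensorProduct.map_tmul, map_one]
    rfl
  let E₂ : MvPolynomial X (ZMod p) ⊗[ZMod p] (MvPolynomial T (ZMod p) ⊗[ZMod p] Tw) ≃ₐ[ZMod p]
      MvPolynomial (X ⊕ T) (ZMod p) ⊗[ZMod p] Tw :=
    (Algebra.TensorProduct.assoc (ZMod p) (ZMod p) (ZMod p) _ _ _).symm.trans
      (Algebra.TensorProduct.congr (tensorEquivSum (ZMod p) X T (ZMod p)) AlgEquiv.refl)
  have hE : ∀ (x : MvPolynomial X (ZMod p)) (y : MvPolynomial T (ZMod p)) (z : Tw),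
      E₂ (x ⊗ₜ (y ⊗ₜ z)) = tensorEquivSum (ZMod p) X T (ZMod p) (x ⊗ₜ y) ⊗ₜ z := fun _ _ _ => rfl
  have hE' : ∀ x y, ((Algebra.TensorProduct.congr AlgEquiv.refl E₁).trans E₂) (x ⊗ₜ y) =
      E₂ (x ⊗ₜ E₁ y) := fun _ _ => rfl
  refine ⟨(Algebra.TensorProduct.congr AlgEquiv.refl E₁).trans E₂, fun x => ?_, fun w => ?_,
    fun w => ?_⟩
  · rw [hE', map_one, Algebra.TensorProduct.one_def, hE, tensorEquivSum_X_tmul_one]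
  · rw [hE', hE₁, hE, tensorEquivSum_one_tmul_X]
  · rw [hE', hE₂, hE, ← Algebra.TensorProduct.one_def, map_one]

/-! ### The free commutative Rota-Baxter algebras -/

theorem mainTheorem9 (p : ℕ) [Fact p.Prime] (X : Type*) [Finite X] [DecidableEq X] :
    -- weight zero, generating algebra `F_p[X]`
    (∀ [LinearOrder (FreeCommMonoid X)] [WellFoundedLT (FreeCommMonoid X)],
      ∃ e : FreeCommRotaBaxter (ZMod p) 0 (MvPolynomial X (ZMod p)) ≃ₐ[ZMod p]
          MvPolynomial X (ZMod p) ⊗[ZMod p] TruncAlg p (setTL p (FreeCommMonoid X)),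
        (∀ a : MvPolynomial X (ZMod p), e (a ⊗ₜ 1) = a ⊗ₜ 1) ∧
        ∀ w : setTL p (FreeCommMonoid X),
          e (1 ⊗ₜ MixableShuffle.word 0 (FreeCommMonoid.toPoly (ZMod p)) w.1) =
            1 ⊗ₜ PresentedAlg.gen _ w) ∧
    -- non-zero weight, generating algebra `F_p[X]`
    (∀ lam : ZMod p, lam ≠ 0 →
      ∀ [LinearOrder (FreeCommMonoid X)], InClassG p (FreeCommMonoid X) →
      ∃ e : FreeCommRotaBaxter (ZMod p) lam (MvPolynomial X (ZMod p)) ≃ₐ[ZMod p]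
          MvPolynomial (X ⊕ setTEL₂ p (FreeCommMonoid X)) (ZMod p) ⊗[ZMod p]
            TwistAlg p (fun w : setW p (FreeCommMonoid X) => wordScalar lam w.1),
        (∀ x : X, e (MvPolynomial.X x ⊗ₜ 1) = MvPolynomial.X (Sum.inl x) ⊗ₜ 1) ∧
        (∀ w : setTEL₂ p (FreeCommMonoid X),
          e (1 ⊗ₜ MixableShuffle.word lam (FreeCommMonoid.toPoly (ZMod p)) w.1) =
            MvPolynomial.X (Sum.inr w) ⊗ₜ 1) ∧
        ∀ w : setW p (FreeCommMonoid X),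
          e (1 ⊗ₜ MixableShuffle.word lam (FreeCommMonoid.toPoly (ZMod p)) w.1) =
            1 ⊗ₜ PresentedAlg.gen _ w) ∧
    -- non-zero weight, generating algebra `F_p[X] / ⟨x^p - x⟩`
    (∃ f : MonoidAlgebra (ZMod p) (IdemMonoid p X) ≃ₐ[ZMod p] IdemAlg p X,
      (∀ x : X, f (MonoidAlgebra.of (ZMod p) (IdemMonoid p X) (IdemMonoid.gen p x)) =
        PresentedAlg.gen _ x) ∧
      ∀ lam : ZMod p, lam ≠ 0 → ∀ [LinearOrder (IdemMonoid p X)],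
      ∃ e : FreeCommRotaBaxter (ZMod p) lam (IdemAlg p X) ≃ₐ[ZMod p]
          TwistAlg p (Sum.elim (fun _ : X => (1 : ZMod p))
            (fun w : setTEL p (IdemMonoid p X) => wordScalar lam w.1)),
        (∀ x : X, e (PresentedAlg.gen _ x ⊗ₜ 1) =
          PresentedAlg.gen _ (Sum.inl x)) ∧
        ∀ w : setTEL p (IdemMonoid p X),
          e (1 ⊗ₜ MixableShuffle.word lam
              (fun s => f (MonoidAlgebra.of (ZMod p) (IdemMonoid p X) s)) w.1) =
            PresentedAlg.gen _ (Sum.inr w)) ∧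
    -- non-zero weight, generating algebra `F_p[X] / ⟨x^p - 1⟩`
    (∃ f : MonoidAlgebra (ZMod p) (ElemGroup p X) ≃ₐ[ZMod p] ElemAlg p X,
      (∀ x : X, f (MonoidAlgebra.of (ZMod p) (ElemGroup p X) (ElemGroup.gen p x)) =
        PresentedAlg.gen _ x) ∧
      ∀ lam : ZMod p, lam ≠ 0 → ∀ [LinearOrder (ElemGroup p X)], (∀ s : ElemGroup p X, 1 ≤ s) →
      ∃ e : FreeCommRotaBaxter (ZMod p) lam (ElemAlg p X) ≃ₐ[ZMod p]
          ElemAlg p X ⊗[ZMod p]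
            (TwistAlg p (fun w : setTL₁ p (ElemGroup p X) => wordScalar lam w.1) ⊗[ZMod p]
              TruncAlg p (setTL₂Diff p lam
                (fun s => f (MonoidAlgebra.of (ZMod p) (ElemGroup p X) s)))),
        (∀ a : ElemAlg p X, e (a ⊗ₜ 1) = a ⊗ₜ 1) ∧
        (∀ w : setTL₁ p (ElemGroup p X),
          e (1 ⊗ₜ MixableShuffle.word lam
              (fun s => f (MonoidAlgebra.of (ZMod p) (ElemGroup p X) s)) w.1) =
            1 ⊗ₜ (PresentedAlg.gen _ w ⊗ₜ 1)) ∧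
        ∀ z : setTL₂Diff p lam (fun s => f (MonoidAlgebra.of (ZMod p) (ElemGroup p X) s)),
          e (1 ⊗ₜ z.1) = 1 ⊗ₜ (1 ⊗ₜ PresentedAlg.gen _ z)) := by
  refine ⟨?_, ?_, ?_, ?_⟩
  · intro _ _
    exact freeCommRotaBaxter_weight_zero p X
  · intro lam hlam _ hG
    exact freeCommRotaBaxter_mvPolynomial p X hlam hG
  · obtain ⟨f, hf⟩ := IdemMonoid.exists_algEquiv p X
    exact ⟨f, hf, fun lam hlam _ => freeCommRotaBaxter_idemAlg p X f hlam⟩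
  · obtain ⟨f, hf⟩ := ElemGroup.exists_algEquiv p X
    exact ⟨f, hf, fun lam hlam _ h1 => freeCommRotaBaxter_elemAlg p X f hlam h1⟩
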